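/- Conventions. A dg-module is a $\mathbb Z$-graded chain complex of $\mathbb Z$-modules, with differential of degree $-1$. For $r\ge 1$ let $\mathcal K(r)$ be the poset of oriented weight systems $\kappa=(\mu,\sigma)$, where $\mu=\{\mu_{ij}\}$ is a family of non-negative integers indexed by the pairs $\{i,j\}\subset\{1,\dots,r\}$, $i\ne j$, and $\sigma\in\Sigma_r$. Write $\sigma|_{ij}$ for the order in which $i,j$ occur in the sequence $(\sigma(1),\dots,\sigma(r))$. By definition $(\mu,\sigma)\le(\nu,\tau)$ if for every pair $\{i,j\}$ either $\mu_{ij}<\nu_{ij}$ or $(\mu_{ij},\sigma|_{ij})=(\nu_{ij},\tau|_{ij})$; the same relation is used for integer weights. Set $\mathcal K(0)=\emptyset$. The group $\Sigma_r$ acts on $\mathcal K(r)$ by $w(\mu,\sigma)=(w\mu,w\sigma)$, $(w\mu)_{ij}=\mu_{w^{-1}(i)w^{-1}(j)}$. A symmetric $\mathcal K$-diagram $M$ consists of functors $M:\mathcal K(r)\to\{\text{dg-modules}\}$, $r\in\mathbb N$, with morphisms $w_*:M(\kappa)\to M(w\kappa)$, $w\in\Sigma_r$, that define an action of $\Sigma_r$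 and commute with the structure maps $M(\alpha)\to M(\beta)$, $\alpha\le\beta$. We consider the category of symmetric $\mathcal K$-diagrams with $M(0)=M(1)=0$. In its model structure a morphism $f$ is a weak equivalence (respectively a fibration) if every $f(\kappa)$ is a quasi-isomorphism (respectively is surjective in every degree), and the cofibrations are the morphisms that have the left lifting property with respect to all morphisms that are both weak equivalences and fibrations. For a simplex $\underline w=(w_0,\dots,w_d)\in\Sigma_r^{d+1}$ let $\mu_{ij}(\underline w)$ be the number of variations in the sequence $(w_0|_{ij},\dots,w_d|_{ij})$, and $\kappa(\underline w)=(\mu(\underline w),w_d)$. Let $\mathcal E_n(r)$ be the dg-module which is free in degree $d$ on the simplices $\underline w=(w_0,\dots,w_d)$ such that $w_k\ne w_{k+1}$ for all $k$ and $\mu_{ij}(\underline w)<n$ for all $i\neq j$, with differential $\sum_k(-1)^k(w_0,\dots,\widehat{w_k},\dots,w_d)$, degenerate simplices being set to zero, and with the diagonal left translation action of $\Sigma_r$. These are the terms of the $n$-th layer of the Barratt–Eccles operad. For $r\geq 2$ let $\mathcal D_n(r)=\Lambda^{-n}\mathcal E_n^\vee(r)=(\Lambda^n\mathcal E_n(r))^\vee$,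 where $\Lambda^n\mathcal E_n(r)$ is $\mathcal E_n(r)$ with degrees shifted by $n(1-r)$ and with the $\Sigma_r$-action twisted by the $n$-th power of the signature. Thus an element of $\mathcal D_n(r)$ of degree $m$ is an integer function $c$ on the basis simplices of degree $n(r-1)-m$. For $\kappa=(\mu,\sigma)\in\mathcal K(r)$ put $$\mathcal D_n(\kappa)=\{c\in\mathcal D_n(r)\ :\ c(\underline w)\ne 0\Rightarrow\kappa(\underline w)\ge(n-1-\mu,\sigma)\},$$ where $n-1-\mu=\{n-1-\mu_{ij}\}$, and set $\mathcal D_n(\kappa)=0$ for $r\le 1$. These dg-modules, with the inclusions and the action of $\Sigma_r$ on $\mathcal D_n(r)$, form a symmetric $\mathcal K$-diagram $\mathcal D_n$. Let $\operatorname{sgn}(w_0,\dots,w_{r-1})$ be the signature of $(w_0(1),\dots,w_{r-1}(1))$ if this sequence is a permutation of $(1,\dots,r)$, and $0$ otherwise. The suspension $(w_0,\dots,w_d)\mapsto\operatorname{sgn}(w_0,\dots,w_{r-1})\cdot(w_{r-1},\dots,w_d)$ (zero for $d<r-1$) is a morphism $\sigma:\mathcal E_n\to\Lambda^{-1}\mathcal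 E_{n-1}$, and its dual $$\sigma^*(c)(w_0,\dots,w_d)=\operatorname{sgn}(w_0,\dots,w_{r-1})\cdot c(w_{r-1},\dots,w_d)$$ is a morphism of symmetric $\mathcal K$-diagrams $\sigma^*:\mathcal D_{n-1}\to\mathcal D_n$. **Proposition.** For all $n>1$, the morphism of symmetric $\mathcal K$-diagrams $\sigma^*:\mathcal D_{n-1}\to\mathcal D_n$ is a cofibration. -/

import Mathlib

open CategoryTheory

namespace BarrattEccles

/-! ## Oriented weight systems (complete graph posets) -/

/-- `orient i j s` is the orientation `s|_{ij}` of the edge `{i, j}`: it is `true` when `i` occurs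
before `j` in the sequence of values `(s 1, …, s r)`, and `false` otherwise. -/
def orient {r : ℕ} (i j : Fin r) (s : Equiv.Perm (Fin r)) : Bool :=
  decide (s⁻¹ i < s⁻¹ j)

/-- Oriented weight systems `(μ, σ)` on `r` vertices with weights in `A`. The weights are indexed by
pairs `{i, j}` of distinct vertices: we store them as a symmetric function with zero diagonal. -/
@[ext]
structure WeightSystem (A : Type) [Zero A] (r : ℕ) where
  weight : Fin r → Fin r → A
  weight_symm : ∀ i j, weight i j = weight j i
  weight_diag : ∀ i, weight i i = 0
  perm : Equiv.Perm (Fin r)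

namespace WeightSystem

variable {A : Type} [Zero A] {r : ℕ}

/-- `(μ, σ) ≤ (ν, τ)` when, for every pair `{i, j}`, either `μ_{ij} < ν_{ij}` or
`(μ_{ij}, σ|_{ij}) = (ν_{ij}, τ|_{ij})`. -/
instance [LT A] : LE (WeightSystem A r) where
  le a b := ∀ i j, i ≠ j → a.weight i j < b.weight i j ∨
    (a.weight i j = b.weight i j ∧ orient i j a.perm = orient i j b.perm)

theorem le_refl [LT A] (a : WeightSystem A r) : a ≤ a :=
  fun _ _ _ => Or.inr ⟨rfl, rfl⟩

theorem le_trans [Preorder A] {a b c : WeightSystem A r} (h : a ≤ b) (h' : b ≤ c) : a ≤ c := by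
  intro i j hij
  rcases h i j hij with h1 | ⟨h1, h2⟩ <;> rcases h' i j hij with h3 | ⟨h3, h4⟩
  · exact Or.inl (h1.trans h3)
  · exact Or.inl (h3 ▸ h1)
  · exact Or.inl (h1 ▸ h3)
  · exact Or.inr ⟨h1.trans h3, h2.trans h4⟩

/-- The action of permutations: `w (μ, σ) = (w μ, w σ)` with `(w μ)_{ij} = μ_{w⁻¹(i) w⁻¹(j)}`. -/
instance : SMul (Equiv.Perm (Fin r)) (WeightSystem A r) where
  smul w a :=
    { weight := fun i j => a.weight (w⁻¹ i) (w⁻¹ j)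
      weight_symm := fun _ _ => a.weight_symm _ _
      weight_diag := fun _ => a.weight_diag _
      perm := w * a.perm }

theorem smul_weight (w : Equiv.Perm (Fin r)) (a : WeightSystem A r) (i j : Fin r) :
    (w • a).weight i j = a.weight (w⁻¹ i) (w⁻¹ j) := rfl

theorem smul_perm (w : Equiv.Perm (Fin r)) (a : WeightSystem A r) :
    (w • a).perm = w * a.perm := rfl

theorem one_smul' (a : WeightSystem A r) : (1 : Equiv.Perm (Fin r)) • a = a := by
  ext <;> simp [smul_weight, smul_perm]

theorem mul_smul' (v w : Equiv.Perm (Fin r)) (a : WeightSystem A r) :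
    (v * w) • a = v • w • a := by
  ext <;> simp [smul_weight, smul_perm]

theorem orient_mul (i j : Fin r) (w s : Equiv.Perm (Fin r)) :
    orient i j (w * s) = orient (w⁻¹ i) (w⁻¹ j) s := by
  simp [orient]

theorem smul_le_smul [LT A] (w : Equiv.Perm (Fin r)) {a b : WeightSystem A r} (h : a ≤ b) :
    w • a ≤ w • b := by
  intro i j hij
  simpa only [smul_weight, smul_perm, orient_mul] using h (w⁻¹ i) (w⁻¹ j) (by simpa using hij)

/-- Regard natural number weights as integer weights. -/
def toInt (a : WeightSystem ℕ r) : WeightSystem ℤ r where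
  weight i j := a.weight i j
  weight_symm i j := by rw [a.weight_symm]
  weight_diag i := by simp [a.weight_diag]
  perm := a.perm

/-- The complement `κ^∨ = (n - 1 - μ, σ)` of `κ = (μ, σ)`; it may have negative weights. -/
def complement (n : ℕ) (a : WeightSystem ℕ r) : WeightSystem ℤ r where
  weight i j := if i = j then 0 else (n : ℤ) - 1 - a.weight i j
  weight_symm i j := by simp only [eq_comm (a := i), a.weight_symm i j]
  weight_diag i := by simp
  perm := a.perm

end WeightSystem

/-! ## Symmetric `K`-diagrams and their cofibrations -/

/-- Chain complexes of `ℤ`-modules, graded by `ℤ`, with a differential of degree `-1`. -/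
abbrev DGMod := ChainComplex (ModuleCat.{0} ℤ) ℤ

/-- The objects of arity `r` of the category `KΣ_*`: the elements of the complete graph poset
`K(r)`, with the convention `K(0) = ∅`. -/
structure KSigma (r : ℕ) where
  system : WeightSystem ℕ r
  arity_pos : 0 < r

/-- Every composite of order relations and of permutations `κ → w κ` is uniquely the composite of
a permutation `α → w α` followed by an order relation `w α ≤ β`. -/
instance (r : ℕ) : Category (KSigma r) where
  Hom a b := {w : Equiv.Perm (Fin r) // w • a.system ≤ b.system}
  id a := ⟨1, by rw [WeightSystem.one_smul']; exact WeightSystem.le_refl _⟩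
  comp f g := ⟨g.1 * f.1, by
    rw [WeightSystem.mul_smul']
    exact WeightSystem.le_trans (WeightSystem.smul_le_smul _ f.2) g.2⟩
  id_comp _ := Subtype.ext (mul_one _)
  comp_id _ := Subtype.ext (one_mul _)
  assoc _ _ _ := Subtype.ext (mul_assoc _ _ _).symm

/-- Sequences of `K(r)`-diagrams of dg-modules with compatible actions of the symmetric groups. -/
abbrev SymKDiagram := ∀ r : ℕ, KSigma r ⥤ DGMod

/-- The condition `M(0) = M(1) = 0`. -/
def isReduced : ObjectProperty SymKDiagram :=
  fun M => ∀ r : ℕ, r ≤ 1 → ∀ k : KSigma r, Limits.IsZero ((M r).obj k)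

/-- The category of symmetric `K`-diagrams `M` such that `M(0) = M(1) = 0`. -/
abbrev ReducedSymKDiagram := isReduced.FullSubcategory

/-- The objectwise quasi-isomorphisms. -/
def weakEquivalences : MorphismProperty ReducedSymKDiagram :=
  fun _ _ f => ∀ (r : ℕ) (k : KSigma r), QuasiIso ((f.hom r).app k)

/-- The objectwise degreewise surjections. -/
def fibrations : MorphismProperty ReducedSymKDiagram :=
  fun _ _ f => ∀ (r : ℕ) (k : KSigma r) (m : ℤ), Function.Surjective (((f.hom r).app k).f m)

/-- The morphisms with the left lifting property with respect to acyclic fibrations. -/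
def cofibrations : MorphismProperty ReducedSymKDiagram :=
  (weakEquivalences ⊓ fibrations).llp

/-! ## Simplices of permutations -/

/-- A simplex `(w_0, …, w_d)` of permutations is represented by the list `[w_0, …, w_d]`. -/
abbrev PermList (r : ℕ) := List (Equiv.Perm (Fin r))

/-- The number of variations in a sequence. -/
def changes : List Bool → ℕ
  | [] => 0
  | [_] => 0
  | a :: b :: l => (if a = b then 0 else 1) + changes (b :: l)

/-- `μ_{ij}(w_0, …, w_d)`: the number of variations in `(w_0|_{ij}, …, w_d|_{ij})`. -/
def variation {r : ℕ} (l : PermList r) (i j : Fin r) : ℕ := changes (l.map (orient i j))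

theorem changes_map_not (b : List Bool) : changes (b.map (! ·)) = changes b := by
  induction b with
  | nil => rfl
  | cons x t ih =>
    cases t with
    | nil => rfl
    | cons y t => simp only [List.map_cons, changes] at ih ⊢; rw [ih]; simp

theorem changes_const (n : ℕ) (x : Bool) : changes (List.replicate n x) = 0 := by
  induction n with
  | zero => rfl
  | succ n ih =>
    cases n with
    | zero => rfl
    | succ n => simpa [List.replicate_succ, changes] using ih

theorem orient_symm {r : ℕ} {i j : Fin r} (h : i ≠ j) (s : Equiv.Perm (Fin r)) :
    orient j i s = !orient i j s := by
  have : s⁻¹ i ≠ s⁻¹ j := fun e => h (s⁻¹.injective e)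
  unfold orient
  rw [← decide_not]
  congr 1
  rw [not_lt]
  exact propext ⟨_root_.le_of_lt, fun e => lt_of_le_of_ne e this.symm⟩

theorem variation_self {r : ℕ} (l : PermList r) (i : Fin r) : variation l i i = 0 := by
  have : l.map (orient i i) = List.replicate l.length false := by
    simp [List.eq_replicate_iff, orient]
  rw [variation, this, changes_const]

theorem variation_symm {r : ℕ} (l : PermList r) (i j : Fin r) :
    variation l i j = variation l j i := by
  by_cases h : i = j
  · rw [h]
  · have : l.map (orient j i) = (l.map (orient i j)).map (! ·) := by
      rw [List.map_map]
      exact List.map_congr_left fun s _ => orient_symm h s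
    rw [variation, variation, this, changes_map_not]

/-- `κ(w_0, …, w_d) = (μ(w_0, …, w_d), w_d)`, for a simplex of permutations. -/
def simplexSystem {r : ℕ} (l : PermList r) : WeightSystem ℕ r where
  weight := variation l
  weight_symm := variation_symm l
  weight_diag := variation_self l
  perm := l.getLastD 1

/-- The set of non-degenerate simplices `(w_0, …, w_d)`, `d ≥ 0`, such that `w_k ≠ w_{k+1}` for all
`k` and `μ_{ij}(w_0, …, w_d) < n` for all pairs `{i, j}`. This is the basis of the `n`-th layer of
the Barratt–Eccles operad in arity `r`; a simplex `(w_0, …, w_d)` has degree `d`. -/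
def nondeg (n r : ℕ) : Set (PermList r) :=
  {l | l ≠ [] ∧ l.IsChain (· ≠ ·) ∧ ∀ i j, i ≠ j → variation l i j < n}

/-- The dg-module `D_n(κ)` in degree `m`. The Barratt–Eccles dg-module `E_n(r)` is free on `nondeg n r`,
and `D_n(r) = Λ^{-n} E_n^∨(r) = (Λ^n E_n(r))^∨` is the dual of `E_n(r)` shifted by `n (r - 1)`.
Thus a homogeneous element of degree `m` is a function on `nondeg n r` (extended by zero to all lists)
supported on the simplices of degree `d = n (r - 1) - m`. The submodule `D_n(κ)` consists of the
functions `c` such that `c(w) ≠ 0` implies `κ(w) ≥ κ^∨`. We take `D_n(0) = D_n(1) = 0`. -/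
def dualModule (n : ℕ) {r : ℕ} (k : KSigma r) (m : ℤ) : Submodule ℤ (PermList r → ℤ) where
  carrier := {c | ∀ l, c l ≠ 0 → 2 ≤ r ∧ l ∈ nondeg n r ∧
    ((l.length : ℤ) - 1) + m = n * ((r : ℤ) - 1) ∧
    k.system.complement n ≤ (simplexSystem l).toInt}
  zero_mem' := fun _ h => absurd rfl h
  add_mem' := fun {a b} ha hb l h => by
    by_cases h' : a l = 0
    · exact hb l fun h'' => h (by simp [h', h''])
    · exact ha l h'
  smul_mem' := fun z a ha l h => ha l fun h' => h (by simp [h'])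

open scoped Classical in
/-- The differential of `D_n(r)`, dual to
`δ(w_0, …, w_d) = ∑ (-1)^i (w_0, …, ŵ_i, …, w_d)` in the normalized complex `E_n(r)`.
For `c` of degree `m` in `D_n(r) = Hom(Λ^n E_n(r), ℤ)`, the sign of the differential of `c` is
`-(-1)^m` for the dual and `(-1)^(n (r - 1))` for the suspension; their product is `(-1)^d`
when the differential is evaluated on a simplex of degree `d = n (r - 1) - (m - 1)`. -/
noncomputable def dualDifferential (n r : ℕ) : (PermList r → ℤ) →ₗ[ℤ] (PermList r → ℤ) where
  toFun c l := if l ∈ nondeg n r then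
    (-1) ^ (l.length - 1) * ∑ i ∈ Finset.range l.length, (-1) ^ i * c (l.eraseIdx i) else 0
  map_add' a b := by
    ext l
    simp only [Pi.add_apply, mul_add, Finset.sum_add_distrib]
    split_ifs <;> simp
  map_smul' z a := by
    ext l
    simp only [Pi.smul_apply, smul_eq_mul, RingHom.id_apply, mul_ite, mul_zero, Finset.mul_sum]
    split_ifs
    · exact Finset.sum_congr rfl fun _ _ => by ring
    · rfl

/-- The action of a permutation `w` on `D_n(r)`: the dual of the diagonal left translation action on
simplices, twisted by the `n`-th power of the signature. -/
def dualAction (n : ℕ) {r : ℕ} (w : Equiv.Perm (Fin r)) :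
    (PermList r → ℤ) →ₗ[ℤ] (PermList r → ℤ) where
  toFun c l := ((Equiv.Perm.sign w : ℤˣ) : ℤ) ^ n * c (l.map (w⁻¹ * ·))
  map_add' a b := by ext l; simp [mul_add]
  map_smul' z a := by ext l; simp [mul_left_comm]

open scoped Classical in
/-- The cochain `sgn(w_0, …, w_d)`: the signature of `(w_0(1), …, w_d(1))` if this sequence is a
permutation of `(1, …, r)` (in particular `d = r - 1`), and zero otherwise. -/
noncomputable def sgnCochain {r : ℕ} (hr : 0 < r) (l : PermList r) : ℤ :=
  if h : l.length = r ∧ Function.Bijective (fun i : Fin r => l.getD i 1 ⟨0, hr⟩) then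
    ((Equiv.Perm.sign (Equiv.ofBijective _ h.2) : ℤˣ) : ℤ) else 0

open scoped Classical in
/-- The dual of the suspension morphism
`(w_0, …, w_d) ↦ sgn(w_0, …, w_{r-1}) · (w_{r-1}, …, w_d)` from `E_n(r)` to `Λ^{-1} E_{n-1}(r)`. -/
noncomputable def dualSuspension (n : ℕ) {r : ℕ} (hr : 0 < r) :
    (PermList r → ℤ) →ₗ[ℤ] (PermList r → ℤ) where
  toFun c l := if l ∈ nondeg n r then sgnCochain hr (l.take r) * c (l.drop (r - 1)) else 0
  map_add' a b := by
    ext l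
    simp only [Pi.add_apply, mul_add]
    split_ifs <;> simp
  map_smul' z a := by
    ext l
    simp only [Pi.smul_apply, smul_eq_mul, RingHom.id_apply, mul_ite, mul_zero]
    split_ifs
    · ring
    · rfl

/-! ### Facts on simplices -/

theorem changes_eraseIdx (b : List Bool) (k : ℕ) (h : b.eraseIdx k ≠ []) :
    changes (b.eraseIdx k) < changes b ∨
      (changes (b.eraseIdx k) = changes b ∧ (b.eraseIdx k).getLast? = b.getLast?) := by
  induction b generalizing k with
  | nil => simp at h
  | cons a t ih =>
    cases t with
    | nil => cases k <;> simp at h ⊢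
    | cons y t =>
      cases k with
      | zero =>
        simp only [List.eraseIdx_zero, List.tail_cons, changes, List.getLast?_cons_cons]
        split_ifs <;> simp
      | succ k =>
        cases k with
        | zero =>
          cases t with
          | nil => cases a <;> cases y <;> simp [changes]
          | cons z t =>
            simp only [List.eraseIdx_cons_succ, List.eraseIdx_zero, List.tail_cons, changes,
              List.getLast?_cons_cons, and_true]
            cases a <;> cases y <;> cases z <;> simp <;> omega
        | succ k =>
          have := ih (k + 1) (by simp)
          simp only [List.eraseIdx_cons_succ, changes, List.getLast?_cons_cons] at this ⊢
          rcases this with h | ⟨h1, h2⟩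
          · left; omega
          · right; exact ⟨by omega, h2⟩

theorem simplexSystem_eraseIdx_le {r : ℕ} (l : PermList r) (k : ℕ) (h : l.eraseIdx k ≠ []) :
    simplexSystem (l.eraseIdx k) ≤ simplexSystem l := by
  intro i j _
  have h1 := changes_eraseIdx (l.map (orient i j)) k
    (by rw [List.eraseIdx_map]; simpa using h)
  rw [List.eraseIdx_map, List.getLast?_map, List.getLast?_map] at h1
  rcases h1 with h1 | ⟨h1, h2⟩
  · exact Or.inl h1
  · refine Or.inr ⟨h1, ?_⟩
    have hl : l ≠ [] := by rintro rfl; simp at h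
    simp only [simplexSystem, List.getLastD_eq_getLast?]
    rw [List.getLast?_eq_some_getLast h, List.getLast?_eq_some_getLast hl] at h2 ⊢
    simpa using h2

theorem toInt_le {r : ℕ} {a b : WeightSystem ℕ r} (h : a ≤ b) : a.toInt ≤ b.toInt := by
  intro i j hij
  simpa [WeightSystem.toInt] using h i j hij

theorem complement_anti {r : ℕ} (n : ℕ) {a b : WeightSystem ℕ r} (h : a ≤ b) :
    b.complement n ≤ a.complement n := by
  intro i j hij
  simp only [WeightSystem.complement, hij, if_false]
  rcases h i j hij with h | ⟨h1, h2⟩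
  · left; omega
  · right; exact ⟨by omega, h2.symm⟩

theorem complement_smul {r : ℕ} (n : ℕ) (w : Equiv.Perm (Fin r)) (a : WeightSystem ℕ r) :
    (w • a).complement n = w • a.complement n := by
  ext <;> simp [WeightSystem.complement, WeightSystem.smul_weight, WeightSystem.smul_perm]

theorem variation_map_mul {r : ℕ} (w : Equiv.Perm (Fin r)) (l : PermList r) (i j : Fin r) :
    variation (l.map (w * ·)) i j = variation l (w⁻¹ i) (w⁻¹ j) := by
  simp only [variation, List.map_map]
  exact congrArg changes (List.map_congr_left fun s _ => WeightSystem.orient_mul i j w s)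

theorem simplexSystem_map_mul {r : ℕ} (w : Equiv.Perm (Fin r)) {l : PermList r} (h : l ≠ []) :
    simplexSystem (l.map (w * ·)) = w • simplexSystem l := by
  ext1
  · funext i j; exact variation_map_mul w l i j
  · simp only [simplexSystem, WeightSystem.smul_perm, List.getLastD_eq_getLast?,
      List.getLast?_map, List.getLast?_eq_some_getLast h, Option.map_some, Option.getD_some]

theorem map_mul_mem_nondeg {n r : ℕ} (w : Equiv.Perm (Fin r)) {l : PermList r}
    (h : l ∈ nondeg n r) : l.map (w * ·) ∈ nondeg n r := by
  refine ⟨by simpa using h.1, ?_, fun i j hij => ?_⟩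
  · rw [List.isChain_map]
    exact h.2.1.imp fun a b hab e => hab (mul_left_cancel e)
  · rw [variation_map_mul]
    exact h.2.2 _ _ (by simpa using hij)

theorem map_mul_map_inv {r : ℕ} (w : Equiv.Perm (Fin r)) (l : PermList r) :
    (l.map (w⁻¹ * ·)).map (w * ·) = l := by
  simp [List.map_map, Function.comp_def]

theorem map_mul_mem_nondeg_iff {n r : ℕ} (w : Equiv.Perm (Fin r)) {l : PermList r} :
    l.map (w * ·) ∈ nondeg n r ↔ l ∈ nondeg n r := by
  refine ⟨fun h => ?_, map_mul_mem_nondeg w⟩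
  have := map_mul_mem_nondeg w⁻¹ h
  have e := map_mul_map_inv w⁻¹ l
  rw [inv_inv] at e
  rwa [e] at this

theorem eraseIdx_mem_nondeg {n r : ℕ} {l : PermList r} (h : l ∈ nondeg n r) (k : ℕ)
    (h0 : l.eraseIdx k ≠ []) (hc : (l.eraseIdx k).IsChain (· ≠ ·)) :
    l.eraseIdx k ∈ nondeg n r := by
  refine ⟨h0, hc, fun i j hij => lt_of_le_of_lt ?_ (h.2.2 i j hij)⟩
  rcases simplexSystem_eraseIdx_le l k h0 i j hij with h | h
  · exact h.le
  · exact h.1.le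

/-! ### The differential -/

/-- The alternating sum of the values of a function on the faces of a list. -/
def faceSum {r : ℕ} (c : PermList r → ℤ) (l : PermList r) : ℤ :=
  ∑ i ∈ Finset.range l.length, (-1) ^ i * c (l.eraseIdx i)

theorem faceSum_cons {r : ℕ} (c : PermList r → ℤ) (a : Equiv.Perm (Fin r)) (l : PermList r) :
    faceSum c (a :: l) = c l - faceSum (fun t => c (a :: t)) l := by
  simp only [faceSum, List.length_cons, Finset.sum_range_succ', pow_succ, List.eraseIdx_cons_succ]
  simp only [mul_neg, mul_one, neg_mul, Finset.sum_neg_distrib]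
  simp
  ring

theorem faceSum_sub {r : ℕ} (c d : PermList r → ℤ) (l : PermList r) :
    faceSum (fun t => c t - d t) l = faceSum c l - faceSum d l := by
  simp [faceSum, mul_sub]

theorem faceSum_faceSum {r : ℕ} (c : PermList r → ℤ) (l : PermList r) :
    faceSum (faceSum c) l = 0 := by
  induction l generalizing c with
  | nil => simp [faceSum]
  | cons a l ih =>
    rw [faceSum_cons]
    simp only [faceSum_cons]
    rw [faceSum_sub, ih]
    ring

theorem faceSum_degenerate {r : ℕ} (c : PermList r → ℤ)
    (hc : ∀ l : PermList r, ¬ l.IsChain (· ≠ ·) → c l = 0) (l : PermList r)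
    (hl : ¬ l.IsChain (· ≠ ·)) : faceSum c l = 0 := by
  induction l generalizing c with
  | nil => simp at hl
  | cons a s ih =>
    rw [faceSum_cons]
    by_cases hs : s.IsChain (· ≠ ·)
    · cases s with
      | nil => simp at hl
      | cons b s =>
        have hab : a = b := by
          by_contra hab
          exact hl (List.isChain_cons_cons.2 ⟨hab, hs⟩)
        subst hab
        rw [faceSum_cons]
        have : (fun t => c (a :: a :: t)) = fun _ => 0 := by
          funext t
          exact hc _ fun h => (List.isChain_cons_cons.1 h).1 rfl
        rw [this]
        simp [faceSum]
    · rw [hc s hs, ih (fun t => c (a :: t)) (fun t ht => hc _ fun h => ht h.tail) hs, sub_zero]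

theorem dualDifferential_apply (n r : ℕ) (c : PermList r → ℤ) (l : PermList r)
    (hl : l ∈ nondeg n r) :
    dualDifferential n r c l = (-1) ^ (l.length - 1) * faceSum c l := by
  simp [dualDifferential, faceSum, hl]

theorem dualDifferential_apply_of_notMem (n r : ℕ) (c : PermList r → ℤ) (l : PermList r)
    (hl : l ∉ nondeg n r) : dualDifferential n r c l = 0 := by
  simp [dualDifferential, hl]

theorem dualModule_support {n r : ℕ} {k : KSigma r} {m : ℤ} {c : PermList r → ℤ}
    (hc : c ∈ dualModule n k m) {l : PermList r} (hl : l ∉ nondeg n r) : c l = 0 := by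
  by_contra h
  exact hl (hc l h).2.1

theorem dualDifferential_dualDifferential {n r : ℕ} {k : KSigma r} {m : ℤ} {c : PermList r → ℤ}
    (hc : c ∈ dualModule n k m) : dualDifferential n r (dualDifferential n r c) = 0 := by
  funext l
  by_cases hl : l ∈ nondeg n r
  · have hz : ∀ t : PermList r, ¬ t.IsChain (· ≠ ·) → c t = 0 := fun t ht =>
      dualModule_support hc fun h => ht h.2.1
    have : faceSum (dualDifferential n r c) l
        = (-1) ^ (l.length - 1 - 1) * faceSum (faceSum c) l := by
      unfold faceSum
      rw [Finset.mul_sum]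
      refine Finset.sum_congr rfl fun i hi => ?_
      have hi' : i < l.length := Finset.mem_range.1 hi
      change (-1) ^ i * dualDifferential n r c (l.eraseIdx i) = _ * (_ * faceSum c (l.eraseIdx i))
      by_cases ht : l.eraseIdx i ∈ nondeg n r
      · rw [dualDifferential_apply _ _ _ _ ht, List.length_eraseIdx_of_lt hi']
        ring
      · rw [dualDifferential_apply_of_notMem _ _ _ _ ht]
        by_cases h0 : l.eraseIdx i = []
        · simp [h0, faceSum]
        · rw [faceSum_degenerate c hz _ fun h => ht (eraseIdx_mem_nondeg hl i h0 h)]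
          simp
    rw [dualDifferential_apply _ _ _ _ hl, this, faceSum_faceSum]
    simp
  · exact dualDifferential_apply_of_notMem _ _ _ _ hl

theorem dualDifferential_mem {n r : ℕ} {k : KSigma r} {m m' : ℤ} (h : m' + 1 = m)
    (c : PermList r → ℤ) (hc : c ∈ dualModule n k m) :
    dualDifferential n r c ∈ dualModule n k m' := by
  intro l hl
  have hln : l ∈ nondeg n r := by
    by_contra h
    exact hl (dualDifferential_apply_of_notMem _ _ _ _ h)
  rw [dualDifferential_apply _ _ _ _ hln] at hl
  obtain ⟨i, hi, hi'⟩ := Finset.exists_ne_zero_of_sum_ne_zero (right_ne_zero_of_mul hl)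
  obtain ⟨h1, h2, h3, h4⟩ := hc _ (right_ne_zero_of_mul hi')
  have hlt : i < l.length := Finset.mem_range.1 hi
  refine ⟨h1, hln, ?_, WeightSystem.le_trans h4
    (toInt_le (simplexSystem_eraseIdx_le l i h2.1))⟩
  rw [List.length_eraseIdx_of_lt hlt, Nat.cast_sub (by omega)] at h3
  push_cast at h3
  linarith

/-- The dg-module `D_n(κ)`. -/
noncomputable def dualComplex (n : ℕ) {r : ℕ} (k : KSigma r) : DGMod where
  X m := ModuleCat.of ℤ (dualModule n k m)
  d i j := if h : j + 1 = i then
    ModuleCat.ofHom ((dualDifferential n r).restrict (dualDifferential_mem h)) else 0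
  shape i j h := dif_neg h
  d_comp_d' i j l hij hjl := by
    have hij' : j + 1 = i := hij
    have hjl' : l + 1 = j := hjl
    rw [dif_pos hij', dif_pos hjl']
    ext c
    exact congrFun (dualDifferential_dualDifferential c.2) _

/-! ### The action of permutations -/

theorem dualAction_mem {n r : ℕ} {a b : KSigma r} (f : a ⟶ b) (m : ℤ)
    (c : PermList r → ℤ) (hc : c ∈ dualModule n a m) :
    dualAction n f.1 c ∈ dualModule n b m := by
  intro l hl
  obtain ⟨h1, h2, h3, h4⟩ := hc _ (right_ne_zero_of_mul hl)
  have e := map_mul_map_inv f.1 l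
  refine ⟨h1, (map_mul_mem_nondeg_iff _).1 h2, by simpa using h3, ?_⟩
  refine WeightSystem.le_trans (complement_anti n f.2) ?_
  rw [complement_smul, ← e, simplexSystem_map_mul _ h2.1]
  exact WeightSystem.smul_le_smul f.1 h4

theorem dualAction_dualDifferential (n : ℕ) {r : ℕ} (w : Equiv.Perm (Fin r))
    (c : PermList r → ℤ) :
    dualAction n w (dualDifferential n r c) = dualDifferential n r (dualAction n w c) := by
  funext l
  by_cases hl : l ∈ nondeg n r
  · have hl' := map_mul_mem_nondeg w⁻¹ hl
    rw [dualDifferential_apply _ _ _ _ hl]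
    change _ * dualDifferential n r c _ = _
    rw [dualDifferential_apply _ _ _ _ hl']
    simp only [faceSum, List.length_map, dualAction, LinearMap.coe_mk, AddHom.coe_mk,
      List.eraseIdx_map, Finset.mul_sum]
    exact Finset.sum_congr rfl fun _ _ => by ring
  · rw [dualDifferential_apply_of_notMem _ _ _ _ hl]
    change _ * dualDifferential n r c _ = _
    rw [dualDifferential_apply_of_notMem _ _ _ _ (mt (map_mul_mem_nondeg_iff _).1 hl), mul_zero]

/-- The morphism `D_n(α) → D_n(β)` associated to a permutation `w` such that `w α ≤ β`. -/
noncomputable def dualMap (n : ℕ) {r : ℕ} {a b : KSigma r} (f : a ⟶ b) :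
    dualComplex n a ⟶ dualComplex n b where
  f m := ModuleCat.ofHom ((dualAction n f.1).restrict (dualAction_mem f m))
  comm' i j h := by
    have h' : j + 1 = i := h
    simp only [dualComplex, dif_pos h']
    ext c
    exact congrFun (dualAction_dualDifferential n f.1 c.1).symm _

/-- The symmetric `K`-diagram `D_n`. -/
noncomputable def dualDiagram (n : ℕ) : SymKDiagram := fun r =>
  { obj := fun k => dualComplex n k
    map := fun f => dualMap n f
    map_id := fun k => by
      ext m c
      refine Subtype.ext (funext fun l => ?_)
      change ((Equiv.Perm.sign (1 : Equiv.Perm (Fin r)) : ℤˣ) : ℤ) ^ n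
        * c.1 (l.map ((1 : Equiv.Perm (Fin r))⁻¹ * ·)) = c.1 l
      simp
    map_comp := fun {a b d} f g => by
      ext m c
      refine Subtype.ext (funext fun l => ?_)
      change ((Equiv.Perm.sign (g.1 * f.1) : ℤˣ) : ℤ) ^ n * c.1 (l.map ((g.1 * f.1)⁻¹ * ·))
        = ((Equiv.Perm.sign g.1 : ℤˣ) : ℤ) ^ n * (((Equiv.Perm.sign f.1 : ℤˣ) : ℤ) ^ n
          * c.1 ((l.map (g.1⁻¹ * ·)).map (f.1⁻¹ * ·)))
      simp [mul_pow, mul_assoc, Function.comp_def] }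

theorem isReduced_dualDiagram (n : ℕ) : isReduced (dualDiagram n) := by
  intro r hr k
  rw [Limits.IsZero.iff_id_eq_zero]
  ext m c
  refine Subtype.ext (funext fun l => ?_)
  change c.1 l = 0
  by_contra h
  have := (c.2 l h).1
  omega

/-- The symmetric `K`-diagram `D_n`, as an object of the reduced category. -/
noncomputable def D (n : ℕ) : ReducedSymKDiagram := ⟨dualDiagram n, isReduced_dualDiagram n⟩

/-! ### The suspension morphism -/

theorem changes_split (m : ℕ) (b : List Bool) :
    changes b = changes (b.take (m + 1)) + changes (b.drop m) := by
  induction m generalizing b with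
  | zero => cases b <;> simp [changes]
  | succ m ih =>
    cases b with
    | nil => rfl
    | cons x t =>
      cases t with
      | nil => simp [changes]
      | cons y t =>
        have := ih (y :: t)
        simp only [List.take_succ_cons, List.drop_succ_cons, changes] at this ⊢
        omega

theorem changes_pos {b : List Bool} (h : true ∈ b) (h' : false ∈ b) : 0 < changes b := by
  induction b with
  | nil => simp at h
  | cons x t ih =>
    cases t with
    | nil => cases x <;> simp at h h'
    | cons y t =>
      cases x <;> cases y <;> simp_all [changes]

theorem sgnCochain_eq_det {r : ℕ} (hr : 0 < r) (l : PermList r) (hl : l.length = r) :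
    sgnCochain hr l =
      (Matrix.of fun k i : Fin r => if l.getD k 1 ⟨0, hr⟩ = i then (1 : ℤ) else 0).det := by
  unfold sgnCochain
  split_ifs with h
  · have h1 := Matrix.det_permute (Equiv.ofBijective _ h.2) (1 : Matrix (Fin r) (Fin r) ℤ)
    rw [Matrix.det_one, mul_one] at h1
    refine Eq.trans h1.symm ?_
    congr 1
  · have h2 : ¬ Function.Injective (fun i : Fin r => l.getD i 1 ⟨0, hr⟩) := fun hi =>
      h ⟨hl, Finite.injective_iff_bijective.1 hi⟩
    simp only [Function.Injective, not_forall] at h2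
    obtain ⟨a, b, hab, hne⟩ := h2
    symm
    refine Matrix.det_zero_of_row_eq hne ?_
    funext i
    simp only [Matrix.of_apply]
    rw [hab]

theorem sgnCochain_of_length_ne {r : ℕ} (hr : 0 < r) (l : PermList r) (hl : l.length ≠ r) :
    sgnCochain hr l = 0 :=
  dif_neg fun h => hl h.1

theorem sgnCochain_cocycle {r : ℕ} (hr : 0 < r) (l : PermList r) (hl : l.length = r + 1) :
    ∑ i ∈ Finset.range (r + 1), (-1) ^ i * sgnCochain hr (l.eraseIdx i) = 0 := by
  let N : Matrix (Fin (r + 1)) (Fin (r + 1)) ℤ := Matrix.of fun i j =>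
    Fin.cases 1 (fun j' => if l.getD i 1 ⟨0, hr⟩ = j' then (1 : ℤ) else 0) j
  have hN : N.det = 0 := by
    refine Matrix.exists_mulVec_eq_zero_iff.1 ⟨Fin.cases (-1) fun _ => 1, ?_, ?_⟩
    · intro h
      simpa using congrFun h 0
    · funext i
      simp [Matrix.mulVec, dotProduct, Fin.sum_univ_succ, N]
  rw [Matrix.det_succ_column_zero] at hN
  rw [Finset.sum_range, ← hN]
  refine Finset.sum_congr rfl fun i _ => ?_
  rw [sgnCochain_eq_det hr _ (by rw [List.length_eraseIdx_of_lt (by omega)]; omega)]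
  have : N i 0 = 1 := rfl
  rw [this, mul_one]
  congr 2
  ext k j
  simp only [Matrix.of_apply, Matrix.submatrix_apply, N, Fin.cases_succ]
  have : (l.eraseIdx i).getD k 1 = l.getD (i.succAbove k) 1 := by
    rw [List.getD_eq_getElem?_getD, List.getD_eq_getElem?_getD, List.getElem?_eraseIdx]
    by_cases h : (k : ℕ) < i
    · rw [if_pos h, Fin.succAbove_of_castSucc_lt _ _ (by simpa [Fin.lt_def] using h)]
      rfl
    · rw [if_neg h, Fin.succAbove_of_le_castSucc _ _ (by simpa [Fin.le_def] using h)]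
      rfl
  rw [this]

theorem sgnCochain_degenerate {r : ℕ} (hr : 0 < r) (l : PermList r)
    (hl : ¬ l.IsChain (· ≠ ·)) : sgnCochain hr l = 0 := by
  refine dif_neg fun h => hl ?_
  rw [List.isChain_iff_getElem]
  intro i hi e
  have := @h.2.1 ⟨i, by omega⟩ ⟨i + 1, by omega⟩ (by
    simp only [List.getD_eq_getElem?_getD]
    rw [List.getElem?_eq_getElem hi, List.getElem?_eq_getElem (by omega : i < l.length), e])
  simp at this

theorem sgnCochain_map_mul {r : ℕ} (hr : 0 < r) (w : Equiv.Perm (Fin r)) (l : PermList r) :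
    sgnCochain hr (l.map (w * ·)) = ((Equiv.Perm.sign w : ℤˣ) : ℤ) * sgnCochain hr l := by
  by_cases hl : l.length = r
  · have hf : (fun i : Fin r => (l.map (w * ·)).getD i 1 ⟨0, hr⟩)
        = w ∘ fun i : Fin r => l.getD i 1 ⟨0, hr⟩ := by
      funext i
      have hi : (i : ℕ) < l.length := by omega
      simp [hi]
    by_cases h : Function.Bijective fun i : Fin r => l.getD i 1 ⟨0, hr⟩
    · have h' : Function.Bijective fun i : Fin r => (l.map (w * ·)).getD i 1 ⟨0, hr⟩ := by
        rw [hf]; exact w.bijective.comp h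
      have e1 : sgnCochain hr l = _ := dif_pos ⟨hl, h⟩
      have e2 : sgnCochain hr (l.map (w * ·)) = _ := dif_pos ⟨by simpa using hl, h'⟩
      rw [e1, e2, ← Units.val_mul, ← Equiv.Perm.sign_mul]
      congr 2
      ext1 i
      exact congrFun hf i
    · have e1 : sgnCochain hr l = 0 := dif_neg fun h' => h h'.2
      have e2 : sgnCochain hr (l.map (w * ·)) = 0 := by
        refine dif_neg ?_
        rintro ⟨-, h'⟩
        rw [hf] at h'
        exact h ((Function.Bijective.of_comp_iff' w.bijective _).1 h')
      rw [e1, e2, mul_zero]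
  · rw [sgnCochain_of_length_ne hr l hl, sgnCochain_of_length_ne hr _ (by simpa using hl),
      mul_zero]

theorem sgnCochain_ne_zero {r : ℕ} {hr : 0 < r} {l : PermList r} (h : sgnCochain hr l ≠ 0) :
    l.length = r ∧ ∀ i j, i ≠ j → 0 < variation l i j := by
  unfold sgnCochain at h
  split_ifs at h with h1
  · refine ⟨h1.1, fun i j hij => ?_⟩
    have key : ∀ a b : Fin r, a ≠ b → ∃ s ∈ l, orient a b s = true := by
      intro a b hab
      obtain ⟨k, hk⟩ := h1.2.2 a
      have hk' : (k : ℕ) < l.length := by omega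
      refine ⟨l[k], List.getElem_mem hk', ?_⟩
      simp only [List.getD_eq_getElem?_getD, List.getElem?_eq_getElem hk', Option.getD_some] at hk
      have e : (l[k])⁻¹ a = ⟨0, hr⟩ := by rw [← hk]; simp
      have hne : (l[k])⁻¹ b ≠ ⟨0, hr⟩ := fun e' => hab ((l[k])⁻¹.injective (e.trans e'.symm))
      simp only [orient, decide_eq_true_eq]
      rw [e, Fin.lt_def]
      exact Nat.pos_of_ne_zero fun h0 => hne (Fin.ext h0)
    refine changes_pos ?_ ?_
    · obtain ⟨s, hs, hs'⟩ := key i j hij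
      exact List.mem_map.2 ⟨s, hs, hs'⟩
    · obtain ⟨s, hs, hs'⟩ := key j i hij.symm
      refine List.mem_map.2 ⟨s, hs, ?_⟩
      rw [orient_symm hij.symm, hs']
      rfl
  · exact absurd rfl h

theorem variation_split {r : ℕ} (hr : 0 < r) (l : PermList r) (i j : Fin r) :
    variation l i j = variation (l.take r) i j + variation (l.drop (r - 1)) i j := by
  have := changes_split (r - 1) (l.map (orient i j))
  rw [Nat.sub_add_cancel hr] at this
  simpa only [variation, List.map_take, List.map_drop] using this

theorem dualSuspension_apply (n : ℕ) {r : ℕ} (hr : 0 < r) (c : PermList r → ℤ) (l : PermList r)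
    (hl : l ∈ nondeg n r) :
    dualSuspension n hr c l = sgnCochain hr (l.take r) * c (l.drop (r - 1)) := by
  simp [dualSuspension, hl]

theorem dualSuspension_apply_of_notMem (n : ℕ) {r : ℕ} (hr : 0 < r) (c : PermList r → ℤ)
    (l : PermList r) (hl : l ∉ nondeg n r) : dualSuspension n hr c l = 0 := by
  simp [dualSuspension, hl]

theorem dualSuspension_mem {n r : ℕ} (k : KSigma r) (m : ℤ)
    (c : PermList r → ℤ) (hc : c ∈ dualModule n k m) :
    dualSuspension (n + 1) k.arity_pos c ∈ dualModule (n + 1) k m := by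
  intro l hl
  have hln : l ∈ nondeg (n + 1) r := by
    by_contra h
    exact hl (dualSuspension_apply_of_notMem _ _ _ _ h)
  rw [dualSuspension_apply _ _ _ _ hln] at hl
  obtain ⟨h1, h2, h3, h4⟩ := hc _ (right_ne_zero_of_mul hl)
  obtain ⟨h5, h6⟩ := sgnCochain_ne_zero (left_ne_zero_of_mul hl)
  have hlen : r ≤ l.length := by
    rw [List.length_take] at h5; omega
  refine ⟨h1, hln, ?_, fun i j hij => ?_⟩
  · rw [List.length_drop, Nat.cast_sub (by omega), Nat.cast_sub (by omega)] at h3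
    push_cast at h3 ⊢
    linarith
  · have hv := variation_split k.arity_pos l i j
    have hp := h6 i j hij
    have h7 := h4 i j hij
    have hlast : (simplexSystem l).perm = (simplexSystem (l.drop (r - 1))).perm := by
      simp only [simplexSystem, List.getLastD_eq_getLast?]
      rw [List.getLast?_drop, if_neg (by omega)]
    simp only [WeightSystem.complement, WeightSystem.toInt, hij, if_false] at h7 ⊢
    change _ < (variation l i j : ℤ) ∨ (_ = (variation l i j : ℤ) ∧ _)
    rw [hlast]
    change _ < (variation (l.drop (r - 1)) i j : ℤ) ∨
      (_ = (variation (l.drop (r - 1)) i j : ℤ) ∧ _) at h7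
    rcases h7 with h7 | ⟨h7, h8⟩
    · left; push_cast; omega
    · by_cases h9 : variation (l.take r) i j = 1
      · right; exact ⟨by push_cast; omega, h8⟩
      · left; push_cast; omega

theorem isChain_of_take_drop {r : ℕ} (hr : 0 < r) (l : PermList r)
    (h : (l.take r).IsChain (· ≠ ·)) (h' : (l.drop (r - 1)).IsChain (· ≠ ·)) :
    l.IsChain (· ≠ ·) := by
  rw [List.isChain_iff_getElem] at h h' ⊢
  intro i hi
  by_cases hir : i + 1 < r
  · have := h i (by simp; omega)
    simpa only [List.getElem_take] using this
  · have := h' (i - (r - 1)) (by simp; omega)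
    simp only [List.getElem_drop] at this
    have e1 : r - 1 + (i - (r - 1)) = i := by omega
    have e2 : r - 1 + (i - (r - 1) + 1) = i + 1 := by omega
    simpa only [e1, e2] using this

theorem faceSum_suspension {r : ℕ} (hr : 0 < r) (c : PermList r → ℤ) (h0 : c [] = 0)
    (l : PermList r) :
    faceSum (fun t => sgnCochain hr (t.take r) * c (t.drop (r - 1))) l =
      (-1) ^ (r - 1) * (sgnCochain hr (l.take r) * faceSum c (l.drop (r - 1))) := by
  by_cases hlen : l.length ≤ r
  · have h1 : faceSum (fun t => sgnCochain hr (t.take r) * c (t.drop (r - 1))) l = 0 := by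
      refine Finset.sum_eq_zero fun i hi => ?_
      have hi' : i < l.length := Finset.mem_range.1 hi
      change (-1) ^ i * (sgnCochain hr _ * _) = 0
      rw [sgnCochain_of_length_ne]
      · simp
      · rw [List.length_take, List.length_eraseIdx_of_lt hi']; omega
    rw [h1]
    by_cases hlen' : l.length = r
    · have : (l.drop (r - 1)).length = 1 := by rw [List.length_drop]; omega
      obtain ⟨x, hx⟩ := List.length_eq_one_iff.1 this
      simp [hx, faceSum, h0]
    · rw [sgnCochain_of_length_ne hr (l.take r) (by rw [List.length_take]; omega)]
      simp
  · obtain ⟨e, he⟩ : ∃ e, l.length = r + e := ⟨l.length - r, by omega⟩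
    have hdrop : (l.drop (r - 1)).length = e + 1 := by rw [List.length_drop]; omega
    have hcoc := sgnCochain_cocycle hr (l.take (r + 1)) (by rw [List.length_take]; omega)
    rw [Finset.sum_range_succ] at hcoc
    have hlast : (l.take (r + 1)).eraseIdx r = l.take r := by
      apply List.ext_getElem?
      intro i
      simp only [List.getElem?_eraseIdx, List.getElem?_take]
      grind
    rw [hlast] at hcoc
    unfold faceSum
    rw [he, hdrop, Finset.sum_range_succ', Finset.sum_range_add]
    have hfirst : ∀ i ∈ Finset.range r, (-1 : ℤ) ^ i * (sgnCochain hr ((l.eraseIdx i).take r)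
        * c ((l.eraseIdx i).drop (r - 1)))
        = (-1) ^ i * sgnCochain hr ((l.take (r + 1)).eraseIdx i) * c (l.drop r) := by
      intro i hi
      have hi' : i < r := Finset.mem_range.1 hi
      have e1 : (l.eraseIdx i).take r = (l.take (r + 1)).eraseIdx i := by
        apply List.ext_getElem?
        intro j
        simp only [List.getElem?_eraseIdx, List.getElem?_take]
        grind
      have e2 : (l.eraseIdx i).drop (r - 1) = l.drop r := by
        apply List.ext_getElem?
        intro j
        simp only [List.getElem?_eraseIdx, List.getElem?_drop]
        rw [if_neg (by omega)]
        congr 1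
        omega
      rw [e1, e2, mul_assoc]
    have hsecond : ∀ i ∈ Finset.range e,
        (-1 : ℤ) ^ (r + i) * (sgnCochain hr ((l.eraseIdx (r + i)).take r)
        * c ((l.eraseIdx (r + i)).drop (r - 1)))
        = (-1) ^ (r - 1) * (sgnCochain hr (l.take r)
          * ((-1) ^ (i + 1) * c ((l.drop (r - 1)).eraseIdx (i + 1)))) := by
      intro i hi
      have e1 : (l.eraseIdx (r + i)).take r = l.take r := by
        apply List.ext_getElem?
        intro j
        simp only [List.getElem?_eraseIdx, List.getElem?_take]
        grind
      have e2 : (l.eraseIdx (r + i)).drop (r - 1) = (l.drop (r - 1)).eraseIdx (i + 1) := by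
        apply List.ext_getElem?
        intro j
        simp only [List.getElem?_eraseIdx, List.getElem?_drop]
        by_cases hj : j < i + 1
        · rw [if_pos (by omega), if_pos hj]
        · rw [if_neg (by omega), if_neg hj]
          rfl
      have e3 : r + i = (r - 1) + (i + 1) := by omega
      rw [e1, e2, e3, pow_add]
      ring
    rw [Finset.sum_congr rfl hfirst, Finset.sum_congr rfl hsecond, ← Finset.sum_mul,
      eq_neg_of_add_eq_zero_left hcoc, ← Finset.mul_sum, ← Finset.mul_sum]
    have e4 : (l.drop (r - 1)).eraseIdx 0 = l.drop r := by
      rw [List.eraseIdx_zero, List.tail_drop]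
      congr 1
      omega
    have e5 : (-1 : ℤ) ^ r = -(-1) ^ (r - 1) := by
      obtain ⟨s, rfl⟩ : ∃ s, r = s + 1 := ⟨r - 1, by omega⟩
      simp [pow_succ]
    rw [e4, e5]
    ring

theorem dualSuspension_dualDifferential {n r : ℕ} (k : KSigma r) (m : ℤ)
    (c : PermList r → ℤ) (hc : c ∈ dualModule n k m) :
    dualSuspension (n + 1) k.arity_pos (dualDifferential n r c) =
      dualDifferential (n + 1) r (dualSuspension (n + 1) k.arity_pos c) := by
  have hr := k.arity_pos
  have h0 : c [] = 0 := dualModule_support hc fun h => h.1 rfl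
  funext l
  by_cases hl : l ∈ nondeg (n + 1) r
  · rw [dualSuspension_apply _ _ _ _ hl, dualDifferential_apply _ _ _ _ hl]
    have h1 : faceSum (dualSuspension (n + 1) hr c) l =
        faceSum (fun t => sgnCochain hr (t.take r) * c (t.drop (r - 1))) l := by
      refine Finset.sum_congr rfl fun i _ => ?_
      congr 1
      by_cases ht : l.eraseIdx i ∈ nondeg (n + 1) r
      · rw [dualSuspension_apply _ _ _ _ ht]
      · rw [dualSuspension_apply_of_notMem _ _ _ _ ht]
        symm
        by_contra hne
        have h2 := (hc _ (right_ne_zero_of_mul hne)).2.1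
        have h3 : ((l.eraseIdx i).take r).IsChain (· ≠ ·) := by
          by_contra h
          exact left_ne_zero_of_mul hne (sgnCochain_degenerate hr _ h)
        refine ht (eraseIdx_mem_nondeg hl i ?_ (isChain_of_take_drop hr _ h3 h2.2.1))
        intro h
        rw [h] at h2
        exact h2.1 (by simp)
    rw [h1, faceSum_suspension hr c h0]
    by_cases hs : sgnCochain hr (l.take r) = 0
    · simp [hs]
    · obtain ⟨h5, h6⟩ := sgnCochain_ne_zero hs
      have hlen : r ≤ l.length := by
        rw [List.length_take] at h5; omega
      have hd : l.drop (r - 1) ∈ nondeg n r := by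
        refine ⟨?_, hl.2.1.drop _, fun i j hij => ?_⟩
        · rw [Ne, List.drop_eq_nil_iff]; omega
        · have := variation_split hr l i j
          have := h6 i j hij
          have := hl.2.2 i j hij
          omega
      rw [dualDifferential_apply _ _ _ _ hd, List.length_drop]
      obtain ⟨e, he⟩ : ∃ e, l.length = r + e := ⟨l.length - r, by omega⟩
      have e1 : l.length - (r - 1) - 1 = e := by omega
      have e2 : l.length - 1 = (r - 1) + e := by omega
      have e3 : ((-1 : ℤ) ^ (r - 1)) * (-1) ^ (r - 1) = 1 := by
        rw [← mul_pow]; simp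
      rw [e1, e2, pow_add]
      linear_combination (- (sgnCochain hr (l.take r) * (-1) ^ e * faceSum c (l.drop (r - 1)))) * e3
  · rw [dualSuspension_apply_of_notMem _ _ _ _ hl, dualDifferential_apply_of_notMem _ _ _ _ hl]

theorem dualSuspension_dualAction (n : ℕ) {r : ℕ} (hr : 0 < r) (w : Equiv.Perm (Fin r))
    (c : PermList r → ℤ) :
    dualSuspension (n + 1) hr (dualAction n w c) =
      dualAction (n + 1) w (dualSuspension (n + 1) hr c) := by
  funext l
  change _ = ((Equiv.Perm.sign w : ℤˣ) : ℤ) ^ (n + 1) * dualSuspension (n + 1) hr c _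
  by_cases hl : l ∈ nondeg (n + 1) r
  · rw [dualSuspension_apply _ _ _ _ hl, dualSuspension_apply _ _ _ _ (map_mul_mem_nondeg w⁻¹ hl)]
    change _ * (_ * c ((l.drop (r - 1)).map (w⁻¹ * ·))) = _
    rw [← List.map_take, ← List.map_drop, sgnCochain_map_mul, Equiv.Perm.sign_inv]
    have e : ((Equiv.Perm.sign w : ℤˣ) : ℤ) * ((Equiv.Perm.sign w : ℤˣ) : ℤ) = 1 := by
      rw [← Units.val_mul]; simp
    rw [pow_succ]
    linear_combination (- (((Equiv.Perm.sign w : ℤˣ) : ℤ) ^ n * sgnCochain hr (l.take r)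
      * c ((l.drop (r - 1)).map (w⁻¹ * ·)))) * e
  · rw [dualSuspension_apply_of_notMem _ _ _ _ hl,
      dualSuspension_apply_of_notMem _ _ _ _ (mt (map_mul_mem_nondeg_iff _).1 hl), mul_zero]

/-- The morphism of dg-modules `σ^* : D_n(κ) → D_{n+1}(κ)`. -/
noncomputable def suspensionMap (n : ℕ) {r : ℕ} (k : KSigma r) :
    dualComplex n k ⟶ dualComplex (n + 1) k where
  f m := ModuleCat.ofHom
    ((dualSuspension (n + 1) k.arity_pos).restrict (dualSuspension_mem k m))
  comm' i j h := by
    have h' : j + 1 = i := h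
    simp only [dualComplex, dif_pos h']
    ext c
    exact congrFun (dualSuspension_dualDifferential k i c.1 c.2).symm _

/-- The morphism of symmetric `K`-diagrams `σ^* : D_n → D_{n+1}`, dual to the suspension morphism
`E_{n+1} → Λ^{-1} E_n` of the Barratt–Eccles operad. -/
noncomputable def sigmaStar (n : ℕ) : D n ⟶ D (n + 1) :=
  ObjectProperty.homMk fun r =>
    { app := fun k => suspensionMap n k
      naturality := fun a b f => by
        ext m c
        exact Subtype.ext (dualSuspension_dualAction n a.arity_pos f.1 c.1) }

end BarrattEccles

namespace BarrattEccles

/-! ## A distinguished simplex in the support of the signature cochain -/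

/-! The lifting problem splits into independent problems, one for each arity `r`, since a symmetric
diagram is a family of functors on the categories `KSigma r`. In a fixed arity, three facts suffice.

Degreewise freeness: in each degree, the dual basis element of a simplex `l` lies in `D_n(κ)`
exactly when `dualSystem n l ≤ κ.system`, and `Σ_r` acts freely on simplices, up to signs on the
dual basis. The diagram is therefore free on the orbits of simplices, so a total, natural, additive
relation out of it contains a natural linear map (`exists_natural_section`).

Degreewise splitting: every simplex `l` has an equivariant extension `extend l`, whose first `r`
vertices have signature `±1` and reverse each pair at most once, and whose remaining part is `l`.
Evaluation on `extend l`, corrected by this sign, is a natural equivariant retraction of `σ^*`. It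
does not commute with differentials in general, and need not. Combined with freeness, it produces
maps with prescribed restriction along `σ^*` (`exists_relative_section`).

Boundedness: a non-degenerate simplex with bounded variations has bounded length, so `D_n(r)` lives
in finitely many degrees.

The lift against an acyclic fibration `p` is then built by induction on the degree, starting below
all non-zero terms. A lift in the next degree fails to commute with the differential by a cycle of
`ker p`; as `ker p` is acyclic, this error can be removed (`exists_isDegreeLift_comm`), and freeness
and splitting make the correction natural and compatible with the map already given on `D_n`. -/

/-- The permutation with sequence of values `(r-1-k, r-k, …, r-1, r-2-k, …, 0)`. -/
def tailPerm (r : ℕ) (k : Fin r) : Equiv.Perm (Fin r) where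
  toFun i := ⟨if (i : ℕ) ≤ k then r - 1 - k + i else r - 1 - i, by split_ifs <;> omega⟩
  invFun j := ⟨if r - 1 - k ≤ (j : ℕ) then j - (r - 1 - k) else r - 1 - j, by
    split_ifs <;> omega⟩
  left_inv i := by ext; simp only; split_ifs <;> omega
  right_inv i := by ext; simp only; split_ifs <;> omega

theorem tailPerm_zero {r : ℕ} (hr : 0 < r) (k : Fin r) :
    (tailPerm r k ⟨0, hr⟩ : ℕ) = r - 1 - k := by
  change (if (0 : ℕ) ≤ k then r - 1 - k + 0 else r - 1 - 0) = _
  simp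

theorem tailPerm_last {r : ℕ} (k : Fin r) (hk : (k : ℕ) = r - 1) : tailPerm r k = 1 := by
  ext i
  simp only [tailPerm, Equiv.coe_fn_mk, Equiv.Perm.coe_one, id]
  split_ifs <;> omega

/-- Only `i` enters the criterion: once `i` belongs to the increasing block at the front, so does
every larger `j`; otherwise `i` sits in the decreasing tail, after `j`. As `k` grows the answer can
only pass from `false` to `true`. -/
theorem orient_tailPerm {r : ℕ} (k i j : Fin r) (h : i < j) :
    orient i j (tailPerm r k) = decide (r - 1 - k ≤ (i : ℕ)) := by
  have h' : (i : ℕ) < j := h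
  unfold orient
  refine decide_eq_decide.2 ?_
  change (Fin.mk _ _ : Fin r) < Fin.mk _ _ ↔ _
  rw [Fin.mk_lt_mk]
  split_ifs <;> omega

theorem changes_le_one_of_isChain {b : List Bool} (h : b.IsChain (· ≤ ·)) : changes b ≤ 1 := by
  have key : ∀ b : List Bool, (true :: b).IsChain (· ≤ ·) → changes (true :: b) = 0 := by
    intro b
    induction b with
    | nil => intro; rfl
    | cons y t ih =>
      intro h
      obtain ⟨h1, h2⟩ := List.isChain_cons_cons.1 h
      cases y
      · exact absurd h1 (by decide)
      · simpa [changes] using ih h2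
  induction b with
  | nil => simp [changes]
  | cons x t ih =>
    cases x
    · cases t with
      | nil => simp [changes]
      | cons y t =>
        obtain ⟨h1, h2⟩ := List.isChain_cons_cons.1 h
        cases y
        · simpa [changes] using ih h2
        · simp [changes, key t h2]
    · rw [key t h]; omega

/-- The sequence of all the permutations `tailPerm r k`; it starts with the order-reversing
permutation, ends with the identity, and reverses every pair exactly once. -/
def tailSimplex (r : ℕ) : PermList r := List.ofFn (tailPerm r)

theorem length_tailSimplex (r : ℕ) : (tailSimplex r).length = r := List.length_ofFn

theorem variation_tailSimplex_le {r : ℕ} (i j : Fin r) : variation (tailSimplex r) i j ≤ 1 := by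
  have key : ∀ i j : Fin r, i < j → variation (tailSimplex r) i j ≤ 1 := by
    intro i j h
    apply changes_le_one_of_isChain
    rw [List.isChain_iff_getElem]
    intro k hk
    simp only [tailSimplex, List.getElem_map, List.getElem_ofFn, orient_tailPerm _ i j h]
    rw [Bool.le_iff_imp]
    simp only [decide_eq_true_eq]
    omega
  rcases lt_trichotomy i j with h | rfl | h
  · exact key i j h
  · rw [variation_self]; omega
  · rw [variation_symm]; exact key j i h

/-- The first values of the vertices are `r-1, r-2, …, 0`, a permutation. -/
theorem sgnCochain_tailSimplex_ne_zero {r : ℕ} (hr : 0 < r) :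
    sgnCochain hr (tailSimplex r) ≠ 0 := by
  unfold sgnCochain
  rw [dif_pos]
  · exact Units.ne_zero _
  · refine ⟨length_tailSimplex r, Finite.injective_iff_bijective.1 fun a b hab => ?_⟩
    have h : ∀ k : Fin r, (tailSimplex r).getD k 1 = tailPerm r k := by
      intro k
      simp [tailSimplex, List.getD_eq_getElem?_getD]
    simp only [h, Fin.ext_iff, tailPerm_zero hr] at hab
    ext
    omega

theorem sgnCochain_mul_self {r : ℕ} {hr : 0 < r} {l : PermList r} (h : sgnCochain hr l ≠ 0) :
    sgnCochain hr l * sgnCochain hr l = 1 := by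
  unfold sgnCochain at h ⊢
  split_ifs at h ⊢ with h1
  · rw [← Units.val_mul]; simp
  · exact absurd rfl h

/-- The simplex obtained by inserting a translate of `tailSimplex r` in front of `l`, with last
vertex the first vertex of `l`. -/
def extend {r : ℕ} (l : PermList r) : PermList r :=
  ((tailSimplex r).take (r - 1)).map (l.headD 1 * ·) ++ l

theorem drop_extend {r : ℕ} (l : PermList r) : (extend l).drop (r - 1) = l :=
  List.drop_left' (by simp [length_tailSimplex])

theorem take_extend {r : ℕ} (hr : 0 < r) {l : PermList r} (hl : l ≠ []) :
    (extend l).take r = (tailSimplex r).map (l.headD 1 * ·) := by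
  obtain ⟨a, t, rfl⟩ := List.exists_cons_of_ne_nil hl
  have h1 : (((tailSimplex r).take (r - 1)).map (a * ·)).length = r - 1 := by
    simp [length_tailSimplex]
  -- The last vertex of `tailSimplex r` is the identity, so the last vertex of its translate by `a`
  -- is `a` itself: the vertex shared by `take r` and `drop (r - 1)`, which `extend` must not insert
  -- twice.
  have h3 : tailSimplex r = (tailSimplex r).take (r - 1) ++ [1] := by
    conv_lhs => rw [← List.take_append_drop (r - 1) (tailSimplex r)]
    congr 1
    rw [List.drop_eq_getElem_cons (by rw [length_tailSimplex]; omega), List.drop_eq_nil_of_le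
      (by rw [length_tailSimplex]; omega)]
    congr 1
    simp only [tailSimplex, List.getElem_ofFn]
    exact tailPerm_last _ rfl
  simp only [extend, List.headD_cons]
  rw [List.take_append, List.take_of_length_le (by omega), h1, show r - (r - 1) = 1 by omega]
  conv_rhs => rw [h3]
  simp

theorem length_extend {r : ℕ} (l : PermList r) : (extend l).length = r - 1 + l.length := by
  simp [extend, length_tailSimplex]

theorem extend_map_mul {r : ℕ} (w : Equiv.Perm (Fin r)) {l : PermList r} (hl : l ≠ []) :
    extend (l.map (w * ·)) = (extend l).map (w * ·) := by
  obtain ⟨a, t, rfl⟩ := List.exists_cons_of_ne_nil hl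
  simp [extend, Function.comp_def, mul_assoc]

theorem sgnCochain_take_extend {r : ℕ} (hr : 0 < r) {l : PermList r} (hl : l ≠ []) :
    sgnCochain hr ((extend l).take r) ≠ 0 := by
  rw [take_extend hr hl, sgnCochain_map_mul]
  exact mul_ne_zero (Units.ne_zero _) (sgnCochain_tailSimplex_ne_zero hr)

/-- This bound is what allows `extend` to raise `n` by only one, and it keeps the retraction inside
the submodules attached to each `κ`. -/
theorem variation_extend_le {r : ℕ} (hr : 0 < r) {l : PermList r} (hl : l ≠ []) (i j : Fin r) :
    variation (extend l) i j ≤ 1 + variation l i j := by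
  rw [variation_split hr, drop_extend, take_extend hr hl, variation_map_mul]
  exact Nat.add_le_add_right (variation_tailSimplex_le _ _) _

theorem extend_mem_nondeg {n r : ℕ} (hr : 0 < r) {l : PermList r} (hl : l ∈ nondeg n r) :
    extend l ∈ nondeg (n + 1) r := by
  refine ⟨fun h => hl.1 ?_, isChain_of_take_drop hr _ ?_ ?_, fun i j hij => ?_⟩
  · rw [← drop_extend l, h, List.drop_nil]
  · by_contra h
    exact sgnCochain_take_extend hr hl.1 (sgnCochain_degenerate hr _ h)
  · rw [drop_extend]; exact hl.2.1
  · have := variation_extend_le hr hl.1 i j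
    have := hl.2.2 i j hij
    omega

/-! ## The retraction of the suspension morphism -/

open scoped Classical in
/-- A degreewise retraction of the dual suspension. -/
noncomputable def retraction (n : ℕ) {r : ℕ} (hr : 0 < r) :
    (PermList r → ℤ) →ₗ[ℤ] (PermList r → ℤ) where
  toFun c l := if l ∈ nondeg n r then sgnCochain hr ((extend l).take r) * c (extend l) else 0
  map_add' a b := by
    ext l
    simp only [Pi.add_apply, mul_add]
    split_ifs <;> simp
  map_smul' z a := by
    ext l
    simp only [Pi.smul_apply, smul_eq_mul, RingHom.id_apply, mul_ite, mul_zero]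
    split_ifs
    · ring
    · rfl

theorem retraction_apply (n : ℕ) {r : ℕ} (hr : 0 < r) (c : PermList r → ℤ) {l : PermList r}
    (hl : l ∈ nondeg n r) :
    retraction n hr c l = sgnCochain hr ((extend l).take r) * c (extend l) := by
  simp [retraction, hl]

theorem retraction_apply_of_notMem (n : ℕ) {r : ℕ} (hr : 0 < r) (c : PermList r → ℤ)
    {l : PermList r} (hl : l ∉ nondeg n r) : retraction n hr c l = 0 := by
  simp [retraction, hl]

/-- From `n + 1` to `n` the weights of the complement of `κ` drop by exactly one, while removing the
added prefix lowers each variation by at most one. In the case of equality the orientations agree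
because `extend l` and `l` have the same last vertex. The `r - 1` new vertices account for the shift
of degree. -/
theorem retraction_mem {n r : ℕ} (k : KSigma r) (m : ℤ) (c : PermList r → ℤ)
    (hc : c ∈ dualModule (n + 1) k m) : retraction n k.arity_pos c ∈ dualModule n k m := by
  have hr := k.arity_pos
  intro l h
  have hl : l ∈ nondeg n r := by
    by_contra hl
    exact h (retraction_apply_of_notMem _ _ _ hl)
  rw [retraction_apply _ _ _ hl] at h
  obtain ⟨h1, h2, h3, h4⟩ := hc _ (right_ne_zero_of_mul h)
  refine ⟨h1, hl, ?_, fun i j hij => ?_⟩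
  · rw [length_extend] at h3
    push_cast [Nat.cast_sub (show 1 ≤ r by omega)] at h3
    linarith
  · have hv := variation_extend_le hr hl.1 i j
    have h5 := h4 i j hij
    have hlast : (simplexSystem (extend l)).perm = (simplexSystem l).perm := by
      simp only [simplexSystem, List.getLastD_eq_getLast?, extend,
        List.getLast?_append_of_ne_nil _ hl.1]
    simp only [WeightSystem.complement, WeightSystem.toInt, hij, if_false] at h5 ⊢
    rw [hlast] at h5
    change _ < (variation (extend l) i j : ℤ) ∨ (_ = (variation (extend l) i j : ℤ) ∧ _) at h5
    change _ < (variation l i j : ℤ) ∨ (_ = (variation l i j : ℤ) ∧ _)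
    push_cast at h5
    rcases h5 with h5 | ⟨h5, h6⟩
    · left; omega
    · by_cases h7 : variation (extend l) i j = 1 + variation l i j
      · right; exact ⟨by omega, h6⟩
      · left; omega

theorem retraction_dualSuspension {n r : ℕ} (k : KSigma r) (m : ℤ) (c : PermList r → ℤ)
    (hc : c ∈ dualModule n k m) :
    retraction n k.arity_pos (dualSuspension (n + 1) k.arity_pos c) = c := by
  funext l
  by_cases hl : l ∈ nondeg n r
  · rw [retraction_apply _ _ _ hl,
      dualSuspension_apply _ _ _ _ (extend_mem_nondeg k.arity_pos hl), drop_extend, ← mul_assoc,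
      sgnCochain_mul_self (sgnCochain_take_extend k.arity_pos hl.1), one_mul]
  · rw [retraction_apply_of_notMem _ _ _ hl, dualModule_support hc hl]

/-- The actions on the two sides differ by one factor of the signature, which is supplied by the
equivariance of `sgnCochain`. -/
theorem retraction_dualAction (n : ℕ) {r : ℕ} (hr : 0 < r) (w : Equiv.Perm (Fin r))
    (c : PermList r → ℤ) :
    retraction n hr (dualAction (n + 1) w c) = dualAction n w (retraction n hr c) := by
  funext l
  change _ = ((Equiv.Perm.sign w : ℤˣ) : ℤ) ^ n * retraction n hr c _
  by_cases hl : l ∈ nondeg n r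
  · rw [retraction_apply _ _ _ hl, retraction_apply _ _ _ (map_mul_mem_nondeg w⁻¹ hl)]
    change _ * (_ * c ((extend l).map (w⁻¹ * ·))) = _
    rw [extend_map_mul _ hl.1, ← List.map_take, sgnCochain_map_mul, Equiv.Perm.sign_inv]
    ring
  · rw [retraction_apply_of_notMem _ _ _ hl,
      retraction_apply_of_notMem _ _ _ (mt (map_mul_mem_nondeg_iff _).1 hl), mul_zero]

/-! ## Boundedness of the length of the simplices -/

/-- If all orientations agree, then `b⁻¹ ∘ a` is an order automorphism of `Fin r`, and the identity
is the only one. -/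
theorem exists_orient_ne {r : ℕ} {a b : Equiv.Perm (Fin r)} (h : a ≠ b) :
    ∃ i j, orient i j a ≠ orient i j b := by
  by_contra! H
  have H' : ∀ i j, a⁻¹ i < a⁻¹ j ↔ b⁻¹ i < b⁻¹ j := fun i j => by
    simpa [orient] using H i j
  have hs : StrictMono (fun i => b⁻¹ (a i)) := fun i j hij => by
    refine (H' _ _).1 ?_
    simpa using hij
  have he : (StrictMono.orderIsoOfSurjective _ hs
      ((b⁻¹).surjective.comp a.surjective)) = OrderIso.refl (Fin r) := Subsingleton.elim _ _
  apply h
  ext1 i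
  have := DFunLike.congr_fun he i
  change b⁻¹ (a i) = i at this
  rw [Equiv.Perm.inv_eq_iff_eq] at this
  exact this

/-- Two distinct consecutive vertices differ on some pair, so each new vertex raises the total
variation. The sum runs over ordered pairs; this crude bound is enough. -/
theorem length_le_sum_variation {r : ℕ} (l : PermList r) (h : l.IsChain (· ≠ ·)) :
    l.length ≤ 1 + ∑ i, ∑ j, variation l i j := by
  induction l with
  | nil => simp
  | cons a t ih =>
    cases t with
    | nil => simp
    | cons b t =>
      obtain ⟨hab, ht⟩ := List.isChain_cons_cons.1 h
      have h1 := ih ht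
      have h2 : ∑ i, ∑ j, variation (b :: t) i j < ∑ i, ∑ j, variation (a :: b :: t) i j := by
        have hle : ∀ i j, variation (b :: t) i j ≤ variation (a :: b :: t) i j := fun i j => by
          simp [variation, changes]
        obtain ⟨i, j, hij⟩ := exists_orient_ne hab
        refine Finset.sum_lt_sum (fun i _ => Finset.sum_le_sum fun j _ => hle i j)
          ⟨i, Finset.mem_univ _, Finset.sum_lt_sum (fun j _ => hle i j) ⟨j, Finset.mem_univ _, ?_⟩⟩
        simp [variation, changes, hij]
      rw [List.length_cons]
      omega

theorem length_le_of_mem_nondeg {n r : ℕ} {l : PermList r} (hl : l ∈ nondeg n r) :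
    l.length ≤ 1 + r * (r * n) := by
  refine (length_le_sum_variation l hl.2.1).trans (Nat.add_le_add_left ?_ 1)
  have : ∀ i j, variation l i j ≤ n := fun i j => by
    by_cases hij : i = j
    · rw [hij, variation_self]; omega
    · exact (hl.2.2 i j hij).le
  refine (Finset.sum_le_sum fun i _ => Finset.sum_le_sum fun j _ => this i j).trans ?_
  simp

theorem dualModule_eq_zero {n r : ℕ} {k : KSigma r} {m : ℤ}
    (hm : m < (n : ℤ) * (r - 1) - r * (r * n) ∨ (n : ℤ) * (r - 1) < m)
    (c : dualModule n k m) : c = 0 := by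
  refine Subtype.ext (funext fun l => ?_)
  by_contra h
  obtain ⟨-, h2, h3, -⟩ := c.2 l h
  have h4 : (l.length : ℤ) ≤ 1 + r * (r * n) := by exact_mod_cast length_le_of_mem_nondeg h2
  have h5 : 0 < l.length := List.length_pos_iff.2 h2.1
  omega

/-! ## The modules `D_n(κ)` form projective diagrams in each degree -/

/-- The action of a morphism on the elements of a given degree of `D_n`. -/
def dualActionMap (n : ℕ) {r : ℕ} {a b : KSigma r} (f : a ⟶ b) (m : ℤ) :
    dualModule n a m →ₗ[ℤ] dualModule n b m :=
  (dualAction n f.1).restrict (dualAction_mem f m)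

/-- The smallest `κ` such that `D_n(κ)` contains the dual basis element of the simplex `l`. -/
def dualSystem (n : ℕ) {r : ℕ} (l : PermList r) : WeightSystem ℕ r where
  weight i j := if i = j then 0 else n - 1 - variation l i j
  weight_symm i j := by simp only [eq_comm (a := i), variation_symm l i j]
  weight_diag i := by simp
  perm := l.getLastD 1

/-- Complementation reverses the order. The bound on the variations makes the truncated subtraction
in `dualSystem` exact. -/
theorem dualSystem_le_iff {n r : ℕ} {l : PermList r} (hl : ∀ i j, i ≠ j → variation l i j < n)
    (a : WeightSystem ℕ r) :
    dualSystem n l ≤ a ↔ a.complement n ≤ (simplexSystem l).toInt := by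
  refine forall_congr' fun i => forall_congr' fun j => forall_congr' fun hij => ?_
  have := hl i j hij
  simp only [WeightSystem.complement, WeightSystem.toInt, dualSystem, simplexSystem, hij, if_false]
  refine or_congr (by omega) (and_congr (by omega) eq_comm)

theorem getLastD_map_mul {r : ℕ} (w : Equiv.Perm (Fin r)) {l : PermList r} (hl : l ≠ []) :
    (l.map (w * ·)).getLastD 1 = w * l.getLastD 1 :=
  congrArg WeightSystem.perm (simplexSystem_map_mul w hl)

theorem smul_dualSystem {n r : ℕ} (w : Equiv.Perm (Fin r)) {l : PermList r} (hl : l ≠ []) :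
    dualSystem n (l.map (w * ·)) = w • dualSystem n l := by
  ext1
  · funext i j
    simp [dualSystem, WeightSystem.smul_weight, variation_map_mul]
  · exact getLastD_map_mul w hl

/-- The representative, with last vertex the identity, of the orbit of a simplex. -/
def orbitRep {r : ℕ} (l : PermList r) : PermList r := l.map ((l.getLastD 1)⁻¹ * ·)

theorem map_orbitRep {r : ℕ} (l : PermList r) : (orbitRep l).map (l.getLastD 1 * ·) = l :=
  map_mul_map_inv _ _

theorem orbitRep_map_mul {r : ℕ} (w : Equiv.Perm (Fin r)) {l : PermList r} (hl : l ≠ []) :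
    orbitRep (l.map (w * ·)) = orbitRep l := by
  rw [orbitRep, getLastD_map_mul w hl]
  simp [orbitRep, Function.comp_def, mul_assoc]

/-- This is the freeness of the diagram: each dual basis element is defined exactly above one object
of the poset. -/
theorem single_mem_iff {n r : ℕ} {k : KSigma r} {m : ℤ} {l : PermList r} :
    (Pi.single l 1 : PermList r → ℤ) ∈ dualModule n k m ↔ 2 ≤ r ∧ l ∈ nondeg n r ∧
      ((l.length : ℤ) - 1) + m = n * ((r : ℤ) - 1) ∧ dualSystem n l ≤ k.system := by
  constructor
  · intro h
    obtain ⟨h1, h2, h3, h4⟩ := h l (by simp)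
    exact ⟨h1, h2, h3, (dualSystem_le_iff h2.2.2 _).2 h4⟩
  · rintro ⟨h1, h2, h3, h4⟩ t ht
    obtain rfl : t = l := by
      by_contra h
      exact ht (Pi.single_eq_of_ne h _)
    exact ⟨h1, h2, h3, (dualSystem_le_iff h2.2.2 _).1 h4⟩

theorem single_mem_of_apply_ne_zero {n r : ℕ} {k : KSigma r} {m : ℤ} {c : PermList r → ℤ}
    (hc : c ∈ dualModule n k m) {l : PermList r} (hl : c l ≠ 0) :
    (Pi.single l 1 : PermList r → ℤ) ∈ dualModule n k m := by
  obtain ⟨h1, h2, h3, h4⟩ := hc l hl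
  exact single_mem_iff.2 ⟨h1, h2, h3, (dualSystem_le_iff h2.2.2 _).2 h4⟩

theorem dualAction_single {n r : ℕ} (w : Equiv.Perm (Fin r)) (l : PermList r) :
    dualAction n w (Pi.single l 1 : PermList r → ℤ) =
      ((Equiv.Perm.sign w : ℤˣ) : ℤ) ^ n • (Pi.single (l.map (w * ·)) 1 : PermList r → ℤ) := by
  funext t
  change _ * (Pi.single l 1 : PermList r → ℤ) (t.map (w⁻¹ * ·)) = _ * _
  by_cases h : t = l.map (w * ·)
  · subst h
    simp [Function.comp_def]
  · rw [Pi.single_eq_of_ne h, Pi.single_eq_of_ne]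
    rintro rfl
    exact h (map_mul_map_inv w t).symm

theorem sign_pow_mul_self {r : ℕ} (w : Equiv.Perm (Fin r)) (n : ℕ) :
    ((Equiv.Perm.sign w : ℤˣ) : ℤ) ^ n * ((Equiv.Perm.sign w : ℤˣ) : ℤ) ^ n = 1 := by
  rw [← mul_pow, ← Units.val_mul]; simp

theorem length_eq_of_apply_ne_zero {n r : ℕ} {k : KSigma r} {m : ℤ} {c : PermList r → ℤ}
    (hc : c ∈ dualModule n k m) {l : PermList r} (hl : c l ≠ 0) :
    l.length = (n * ((r : ℤ) - 1) - m + 1).toNat := by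
  obtain ⟨-, -, h3, -⟩ := hc l hl
  omega

/-- The canonical object of `K(r)` on which the dual basis element of a simplex is defined. -/
def dualObj (n : ℕ) {r : ℕ} (hr : 0 < r) (l : PermList r) : KSigma r := ⟨dualSystem n l, hr⟩

/-- The morphism from the canonical object of an orbit representative. -/
def orbitHom {n r : ℕ} {hr : 0 < r} {k : KSigma r} {m : ℤ} {l : PermList r}
    (h : (Pi.single l 1 : PermList r → ℤ) ∈ dualModule n k m) :
    dualObj n hr (orbitRep l) ⟶ k :=
  ⟨l.getLastD 1, by
    obtain ⟨-, h2, -, h4⟩ := single_mem_iff.1 h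
    have hne : orbitRep l ≠ [] := fun e => h2.1 (by rw [← map_orbitRep l, e]; rfl)
    have := smul_dualSystem (n := n) (l.getLastD 1) hne
    rw [map_orbitRep] at this
    exact this ▸ h4⟩

theorem single_orbitRep_mem {n r : ℕ} (hr : 0 < r) {k : KSigma r} {m : ℤ} {l : PermList r}
    (h : (Pi.single l 1 : PermList r → ℤ) ∈ dualModule n k m) :
    (Pi.single (orbitRep l) 1 : PermList r → ℤ) ∈
      dualModule n (dualObj n hr (orbitRep l)) m := by
  obtain ⟨h1, h2, h3, -⟩ := single_mem_iff.1 h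
  exact single_mem_iff.2 ⟨h1, map_mul_mem_nondeg _ h2, by simpa [orbitRep] using h3,
    WeightSystem.le_refl _⟩

/-! ### Natural maps prescribed on orbit representatives. -/

section Projective

variable {n r : ℕ} (hr : 0 < r) {m : ℤ} (X : KSigma r ⥤ ModuleCat.{0} ℤ)
  (x : ∀ l : PermList r, X.obj (dualObj n hr l))

open scoped Classical in
/-- The value on a dual basis element of the natural transformation determined by its values on
the orbit representatives. -/
noncomputable def basisValue (m : ℤ) (k : KSigma r) (l : PermList r) : X.obj k :=
  if h : (Pi.single l 1 : PermList r → ℤ) ∈ dualModule n k m then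
    ((Equiv.Perm.sign (l.getLastD 1) : ℤˣ) : ℤ) ^ n •
      X.map (orbitHom (hr := hr) h) (x (orbitRep l)) else 0

/-- The natural transformation determined by values on the orbit representatives. -/
noncomputable def extendByBasis (m : ℤ) (k : KSigma r) : dualModule n k m →ₗ[ℤ] X.obj k where
  -- All lists of the one length that the degree allows: a finite set, containing the support of
  -- `c`. The other lists in it have coefficient zero, and so does every list when `toNat`
  -- truncates.
  toFun c := ∑ l ∈ (List.finite_length_eq (Equiv.Perm (Fin r))
    (n * ((r : ℤ) - 1) - m + 1).toNat).toFinset, c.1 l • basisValue hr X x m k l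
  map_add' a b := by
    rw [← Finset.sum_add_distrib]
    exact Finset.sum_congr rfl fun l _ => add_zsmul _ _ _
  map_smul' z a := by
    rw [Finset.smul_sum]
    refine Finset.sum_congr rfl fun l _ => ?_
    exact (mul_zsmul _ _ _).trans (int_smul_eq_zsmul _ _ _).symm

theorem map_basisValue {a b : KSigma r} (f : a ⟶ b) {l : PermList r}
    (h : (Pi.single l 1 : PermList r → ℤ) ∈ dualModule n a m) :
    X.map f (basisValue hr X x m a l) =
      ((Equiv.Perm.sign f.1 : ℤˣ) : ℤ) ^ n • basisValue hr X x m b (l.map (f.1 * ·)) := by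
  have h2 := (single_mem_iff.1 h).2.1
  have hb : (Pi.single (l.map (f.1 * ·)) 1 : PermList r → ℤ) ∈ dualModule n b m := by
    have := (dualModule n b m).smul_mem (((Equiv.Perm.sign f.1 : ℤˣ) : ℤ) ^ n)
      (dualAction_mem f m _ h)
    rwa [dualAction_single, smul_smul, sign_pow_mul_self, one_smul] at this
  -- The representatives of `l` and of its translate are equal only propositionally, while the types
  -- of `x` and `orbitHom` depend on them. Generalizing over `t` and `u` allows the equalities to be
  -- substituted.
  have key : ∀ (t : PermList r) (u : Equiv.Perm (Fin r)) (ht : t = orbitRep l)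
      (hu : u = f.1 * l.getLastD 1) (p : u • (dualObj n hr t).system ≤ b.system),
      X.map (X := dualObj n hr t) (Y := b) ⟨u, p⟩ (x t) =
        X.map f (X.map (orbitHom (hr := hr) h) (x (orbitRep l))) := by
    rintro t u rfl rfl p
    rw [← ConcreteCategory.comp_apply, ← X.map_comp]
    rfl
  rw [basisValue, dif_pos h, basisValue, dif_pos hb, map_zsmul, orbitHom.eq_1 (l := l.map (f.1 * ·)),
    key _ _ (orbitRep_map_mul f.1 h2.1) (getLastD_map_mul f.1 h2.1), smul_smul,
    getLastD_map_mul f.1 h2.1, Equiv.Perm.sign_mul, Units.val_mul, mul_pow, ← mul_assoc,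
    sign_pow_mul_self, one_mul]

theorem map_extendByBasis {a b : KSigma r} (f : a ⟶ b) (c : dualModule n a m) :
    X.map f (extendByBasis hr X x m a c) = extendByBasis hr X x m b (dualActionMap n f m c) := by
  simp only [extendByBasis, LinearMap.coe_mk, AddHom.coe_mk, map_sum, map_zsmul]
  refine Finset.sum_bij' (fun l _ => l.map (f.1 * ·)) (fun l _ => l.map (f.1⁻¹ * ·))
    ?_ ?_ ?_ ?_ ?_
  · simp
  · simp
  · intro l _; simp [Function.comp_def]
  · intro l _; simp [Function.comp_def]
  · intro l _
    have e : (dualActionMap n f m c).1 (l.map (f.1 * ·)) =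
        ((Equiv.Perm.sign f.1 : ℤˣ) : ℤ) ^ n * c.1 l := by
      change _ * c.1 ((l.map (f.1 * ·)).map (f.1⁻¹ * ·)) = _
      simp [Function.comp_def]
    rw [e]
    by_cases hl : c.1 l = 0
    · rw [hl, zero_smul, mul_zero, zero_smul]
    · rw [map_basisValue hr X x f (single_mem_of_apply_ne_zero c.2 hl), smul_smul, mul_comm]

theorem sum_smul_single {k : KSigma r} (c : dualModule n k m) :
    ∑ l ∈ (List.finite_length_eq (Equiv.Perm (Fin r))
      (n * ((r : ℤ) - 1) - m + 1).toNat).toFinset, c.1 l • (Pi.single l 1 : PermList r → ℤ) =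
      c.1 := by
  funext t
  rw [Finset.sum_apply]
  by_cases ht : c.1 t = 0
  · rw [ht]
    refine Finset.sum_eq_zero fun l _ => ?_
    by_cases hl : l = t
    · simp [hl, ht]
    · simp [Pi.single_eq_of_ne (Ne.symm hl)]
  · rw [Finset.sum_eq_single t]
    · simp
    · intro l _ hl
      simp [Pi.single_eq_of_ne (Ne.symm hl)]
    · intro h
      exact absurd (by simpa using length_eq_of_apply_ne_zero c.2 ht) h

end Projective

/-- The relation `R` encodes whatever conditions the values must satisfy. Values are chosen on orbit
representatives, at the objects where these first appear, and transported by naturality. Membership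
in `R` then extends to all elements, because `R` is additive and stable under the structure maps. -/
theorem exists_natural_section {n r : ℕ} (hr : 0 < r) (m : ℤ) (X : KSigma r ⥤ ModuleCat.{0} ℤ)
    (R : ∀ k, AddSubgroup (dualModule n k m × X.obj k))
    (hmap : ∀ {a b : KSigma r} (f : a ⟶ b) z x, (z, x) ∈ R a →
      (dualActionMap n f m z, X.map f x) ∈ R b)
    (htot : ∀ k z, ∃ x, (z, x) ∈ R k) :
    ∃ θ : ∀ k, dualModule n k m →ₗ[ℤ] X.obj k,
      (∀ {a b : KSigma r} (f : a ⟶ b) z, X.map f (θ a z) = θ b (dualActionMap n f m z)) ∧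
      ∀ k z, (z, θ k z) ∈ R k := by
  have hx : ∀ l : PermList r, ∃ x : X.obj (dualObj n hr l),
      ∀ h : (Pi.single l 1 : PermList r → ℤ) ∈ dualModule n (dualObj n hr l) m,
        (⟨_, h⟩, x) ∈ R (dualObj n hr l) := by
    intro l
    by_cases h : (Pi.single l 1 : PermList r → ℤ) ∈ dualModule n (dualObj n hr l) m
    · obtain ⟨x, hx⟩ := htot _ ⟨_, h⟩
      exact ⟨x, fun _ => hx⟩
    · exact ⟨0, fun h' => absurd h' h⟩
  choose x hx using hx
  have hbasis : ∀ (k : KSigma r) (l : PermList r)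
      (h : (Pi.single l 1 : PermList r → ℤ) ∈ dualModule n k m),
      (⟨_, h⟩, basisValue hr X x m k l) ∈ R k := by
    intro k l h
    have h1 := zsmul_mem (hmap (orbitHom (hr := hr) h) _ _ (hx _ (single_orbitRep_mem hr h)))
      (((Equiv.Perm.sign (l.getLastD 1) : ℤˣ) : ℤ) ^ n)
    rw [basisValue, dif_pos h]
    convert h1 using 1
    refine Prod.ext (Subtype.ext ?_) rfl
    change _ = _ • dualAction n (l.getLastD 1) (Pi.single (orbitRep l) 1)
    rw [dualAction_single, smul_smul, sign_pow_mul_self, one_smul, map_orbitRep]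
  refine ⟨extendByBasis hr X x m, map_extendByBasis hr X x, fun k z => ?_⟩
  classical
  let e : PermList r → dualModule n k m := fun l =>
    if h : (Pi.single l 1 : PermList r → ℤ) ∈ dualModule n k m then ⟨_, h⟩ else 0
  have hz : z = ∑ l ∈ (List.finite_length_eq (Equiv.Perm (Fin r))
      (n * ((r : ℤ) - 1) - m + 1).toNat).toFinset, z.1 l • e l := by
    refine Subtype.ext ?_
    conv_lhs => rw [← sum_smul_single z]
    rw [AddSubmonoidClass.coe_finsetSum]
    refine Finset.sum_congr rfl fun l _ => ?_
    by_cases hl : z.1 l = 0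
    · simp [hl]
    · simp [e, single_mem_of_apply_ne_zero z.2 hl]
  have hsum : (z, extendByBasis hr X x m k z) = ∑ l ∈ (List.finite_length_eq
      (Equiv.Perm (Fin r)) (n * ((r : ℤ) - 1) - m + 1).toNat).toFinset,
      z.1 l • (e l, basisValue hr X x m k l) := by
    refine Prod.ext ?_ ?_
    · rw [Prod.fst_sum]; exact hz
    · rw [Prod.snd_sum]; rfl
  rw [hsum]
  refine sum_mem fun l _ => ?_
  by_cases hl : z.1 l = 0
  · rw [hl, zero_smul]; exact zero_mem _
  · have h := single_mem_of_apply_ne_zero z.2 hl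
    have := zsmul_mem (hbasis k l h) (z.1 l)
    simpa only [e, dif_pos h] using this

/-! ### Extension along the suspension in one degree. -/

/-- The dual suspension in a given degree. -/
noncomputable def dualSuspensionMap (n : ℕ) {r : ℕ} (k : KSigma r) (m : ℤ) :
    dualModule n k m →ₗ[ℤ] dualModule (n + 1) k m :=
  (dualSuspension (n + 1) k.arity_pos).restrict (dualSuspension_mem k m)

/-- In each degree, the dual suspension has the left lifting property with respect to surjections of
diagrams. -/
theorem exists_relative_section {n r : ℕ} (hr : 0 < r) (m : ℤ) (X : KSigma r ⥤ ModuleCat.{0} ℤ)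
    (R : ∀ k, AddSubgroup (dualModule (n + 1) k m × X.obj k))
    (hmap : ∀ {a b : KSigma r} (f : a ⟶ b) z x, (z, x) ∈ R a →
      (dualActionMap (n + 1) f m z, X.map f x) ∈ R b)
    (htot : ∀ k z, ∃ x, (z, x) ∈ R k)
    (ψ₀ : ∀ k, dualModule n k m →ₗ[ℤ] X.obj k)
    (hψ₀ : ∀ {a b : KSigma r} (f : a ⟶ b) y, X.map f (ψ₀ a y) = ψ₀ b (dualActionMap n f m y))
    (hR : ∀ k y, (dualSuspensionMap n k m y, ψ₀ k y) ∈ R k) :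
    ∃ ψ : ∀ k, dualModule (n + 1) k m →ₗ[ℤ] X.obj k,
      (∀ {a b : KSigma r} (f : a ⟶ b) z,
        X.map f (ψ a z) = ψ b (dualActionMap (n + 1) f m z)) ∧
      (∀ k z, (z, ψ k z) ∈ R k) ∧
      ∀ k y, ψ k (dualSuspensionMap n k m y) = ψ₀ k y := by
  obtain ⟨θ, hθ, hθR⟩ := exists_natural_section hr m X R hmap htot
  let σ : ∀ k : KSigma r, dualModule n k m →ₗ[ℤ] dualModule (n + 1) k m := fun k =>
    dualSuspensionMap n k m
  let ρ : ∀ k : KSigma r, dualModule (n + 1) k m →ₗ[ℤ] dualModule n k m := fun k =>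
    (retraction n k.arity_pos).restrict (retraction_mem k m)
  have hρσ : ∀ k y, ρ k (σ k y) = y := fun k y =>
    Subtype.ext (retraction_dualSuspension k m y.1 y.2)
  have hσ : ∀ {a b : KSigma r} (f : a ⟶ b) y,
      dualActionMap (n + 1) f m (σ a y) = σ b (dualActionMap n f m y) := fun f y =>
    Subtype.ext (dualSuspension_dualAction n _ f.1 y.1).symm
  have hρ : ∀ {a b : KSigma r} (f : a ⟶ b) z,
      dualActionMap n f m (ρ a z) = ρ b (dualActionMap (n + 1) f m z) := fun f z =>
    Subtype.ext (retraction_dualAction n _ f.1 z.1).symm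
  -- The given map is used on the image of the idempotent `σρ` and the free choice `θ` on its
  -- complement. Membership in `R` comes from the decomposition `z = σρz + (z - σρz)`.
  refine ⟨fun k => ψ₀ k ∘ₗ ρ k + θ k ∘ₗ (LinearMap.id - σ k ∘ₗ ρ k), ?_, ?_, ?_⟩
  · intro a b f z
    simp only [LinearMap.add_apply, LinearMap.comp_apply, LinearMap.sub_apply, LinearMap.id_apply,
      map_add, map_sub, hψ₀, hθ, hρ, hσ]
  · intro k z
    have := (R k).add_mem (hR k (ρ k z)) (hθR k (z - σ k (ρ k z)))
    simpa [σ] using this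
  · intro k y
    change ψ₀ k (ρ k (σ k y)) + θ k (σ k y - σ k (ρ k (σ k y))) = _
    rw [hρσ, sub_self, map_zero, add_zero]

/-! ## Acyclicity of the kernel of an acyclic fibration -/

/-- The kernel of a surjective quasi-isomorphism is acyclic, so a cycle of the kernel bounds inside
the kernel. -/
theorem exists_preimage_of_quasiIso {X Y : DGMod} (p : X ⟶ Y) [QuasiIso p]
    (hp : ∀ m, Function.Surjective (p.f m)) {i j l : ℤ} (hij : j + 1 = i) (hjl : l + 1 = j)
    (x : X.X j) (hx : X.d j l x = 0) (hpx : p.f j x = 0) :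
    ∃ y : X.X i, X.d i j y = x ∧ p.f i y = 0 := by
  have hepi : Epi p := by
    have : ∀ m, Epi (p.f m) := fun m => (ModuleCat.epi_iff_surjective _).2 (hp m)
    exact HomologicalComplex.epi_of_epi_f p this
  let S : ShortComplex DGMod := ShortComplex.mk (Limits.kernel.ι p) p (Limits.kernel.condition p)
  have hS : S.ShortExact :=
    { exact := ShortComplex.exact_of_f_is_kernel _ (Limits.kernelIsKernel p) }
  have hac : S.X₁.Acyclic := hS.acyclic_X₁ (by assumption)
  have hdeg : ∀ m, (S.map (HomologicalComplex.eval _ _ m)).ShortExact := fun m =>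
    hS.map_of_exact (HomologicalComplex.eval _ _ m)
  have hinj : ∀ m, Function.Injective (S.f.f m) := fun m =>
    (ModuleCat.mono_iff_injective _).1 (hdeg m).mono_f
  obtain ⟨x', hx'⟩ : ∃ x', S.f.f j x' = x :=
    (ShortComplex.moduleCat_exact_iff _).1 (hdeg j).exact x hpx
  have hdx' : S.X₁.d j l x' = 0 := by
    apply hinj l
    have := ConcreteCategory.congr_hom (S.f.comm j l) x'
    simp only [ModuleCat.hom_comp, LinearMap.comp_apply] at this
    rw [← this, hx', map_zero]
    exact hx
  have hex := (S.X₁.exactAt_iff' i j l (by simp [← hij]) (by simp [← hjl])).1 (hac j)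
  obtain ⟨y', hy'⟩ := (ShortComplex.moduleCat_exact_iff _).1 hex x' hdx'
  refine ⟨S.f.f i y', ?_, ?_⟩
  · refine (ConcreteCategory.congr_hom (S.f.comm i j) y').trans ?_
    rw [← hx']
    exact congrArg _ hy'
  · exact ConcreteCategory.congr_hom (HomologicalComplex.congr_hom S.zero i) y'

/-! ## Lifting against acyclic fibrations -/

section Lifting

variable {n r : ℕ} {X Y : KSigma r ⥤ DGMod}

/-- The component of a morphism out of `D_n(r)` in a given degree. -/
noncomputable def degreeMap (b : dualDiagram n r ⟶ Y) (m : ℤ) (k : KSigma r) :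
    dualModule n k m →ₗ[ℤ] (Y.obj k).X m :=
  ((b.app k).f m).hom

/-- The differential of `D_n(κ)` as a linear map. -/
noncomputable def dualDiff (n : ℕ) {r : ℕ} (k : KSigma r) (i j : ℤ) :
    dualModule n k i →ₗ[ℤ] dualModule n k j :=
  ((dualComplex n k).d i j).hom

theorem map_degreeMap (b : dualDiagram n r ⟶ Y) {m : ℤ} {k l : KSigma r} (f : k ⟶ l)
    (z : dualModule n k m) :
    (Y.map f).f m (degreeMap b m k z) = degreeMap b m l (dualActionMap n f m z) :=
  (ConcreteCategory.congr_hom (HomologicalComplex.congr_hom (b.naturality f) m) z).symm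

theorem d_degreeMap (b : dualDiagram n r ⟶ Y) (i j : ℤ) (k : KSigma r) (z : dualModule n k i) :
    (Y.obj k).d i j (degreeMap b i k z) = degreeMap b j k (dualDiff n k i j z) :=
  ConcreteCategory.congr_hom ((b.app k).comm i j) z

theorem dualActionMap_dualDiff {k l : KSigma r} (f : k ⟶ l) (i j : ℤ) (z : dualModule n k i) :
    dualActionMap n f j (dualDiff n k i j z) = dualDiff n l i j (dualActionMap n f i z) :=
  (ConcreteCategory.congr_hom ((dualMap n f).comm i j) z).symm

theorem dualSuspensionMap_dualDiff (k : KSigma r) (i j : ℤ) (y : dualModule n k i) :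
    dualSuspensionMap n k j (dualDiff n k i j y) =
      dualDiff (n + 1) k i j (dualSuspensionMap n k i y) :=
  (ConcreteCategory.congr_hom ((suspensionMap n k).comm i j) y).symm

theorem dualDiff_dualDiff (k : KSigma r) (i j l : ℤ) (z : dualModule n k i) :
    dualDiff n k j l (dualDiff n k i j z) = 0 :=
  ConcreteCategory.congr_hom ((dualComplex n k).d_comp_d i j l) z

/-! ### Lifts in a single degree and their correction. -/

variable (p : X ⟶ Y) (a : dualDiagram n r ⟶ X) (b : dualDiagram (n + 1) r ⟶ Y)

/-- Natural solutions, in a given degree, of the lifting problem given by `a` and `b`. -/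
structure IsDegreeLift (m : ℤ) (ψ : ∀ k, dualModule (n + 1) k m →ₗ[ℤ] (X.obj k).X m) : Prop where
  natural : ∀ {k l : KSigma r} (f : k ⟶ l) z,
    (X.map f).f m (ψ k z) = ψ l (dualActionMap (n + 1) f m z)
  fac_right : ∀ k z, (p.app k).f m (ψ k z) = degreeMap b m k z
  fac_left : ∀ k y, ψ k (dualSuspensionMap n k m y) = degreeMap a m k y

variable {p a b}

theorem map_f_app_f {k l : KSigma r} (f : k ⟶ l) (m : ℤ) (x : (X.obj k).X m) :
    (p.app l).f m ((X.map f).f m x) = (Y.map f).f m ((p.app k).f m x) :=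
  ConcreteCategory.congr_hom (HomologicalComplex.congr_hom (p.naturality f) m) x

theorem exists_isDegreeLift (hr : 0 < r)
    (hp : ∀ k m, Function.Surjective ((p.app k).f m))
    (hab : ∀ m k y, (p.app k).f m (degreeMap a m k y) =
      degreeMap b m k (dualSuspensionMap n k m y)) (m : ℤ) :
    ∃ ψ, IsDegreeLift p a b m ψ := by
  obtain ⟨ψ, h1, h2, h3⟩ := exists_relative_section hr m
    (X ⋙ HomologicalComplex.eval (ModuleCat.{0} ℤ) (ComplexShape.down ℤ) m)
    (fun k =>
      { carrier := {q | (p.app k).f m q.2 = degreeMap b m k q.1}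
        zero_mem' := (map_zero _).trans (map_zero _).symm
        add_mem' := fun {q q'} h h' => (map_add _ q.2 q'.2).trans
          ((congrArg₂ (· + ·) h h').trans (map_add _ q.1 q'.1).symm)
        neg_mem' := fun {q} h => (map_neg _ q.2).trans ((congrArg _ h).trans (map_neg _ q.1).symm) })
    (fun {k l} f z x h => (map_f_app_f f m x).trans
      ((congrArg ((Y.map f).f m) h).trans (map_degreeMap b f z)))
    (fun k z => (hp k m (degreeMap b m k z)).imp fun _ h => h) (degreeMap a m) (map_degreeMap a) (fun k y => hab m k y)
  exact ⟨ψ, h1, h2, h3⟩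

/-- Compatibility with the differential is put into the relation `R`. The uncorrected lift `ψi`
serves to prove that this relation is total and that it contains the values prescribed by `a`. -/
theorem exists_isDegreeLift_comm (hr : 0 < r) (hq : ∀ k, QuasiIso (p.app k))
    (hp : ∀ k m, Function.Surjective ((p.app k).f m)) {i j l : ℤ} (hij : j + 1 = i)
    (hjl : l + 1 = j) {ψi : ∀ k, dualModule (n + 1) k i →ₗ[ℤ] (X.obj k).X i}
    {ψj : ∀ k, dualModule (n + 1) k j →ₗ[ℤ] (X.obj k).X j}
    {ψl : ∀ k, dualModule (n + 1) k l →ₗ[ℤ] (X.obj k).X l}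
    (hi : IsDegreeLift p a b i ψi) (hj : IsDegreeLift p a b j ψj)
    (hcomm : ∀ k z, (X.obj k).d j l (ψj k z) = ψl k (dualDiff (n + 1) k j l z)) :
    ∃ ψ, IsDegreeLift p a b i ψ ∧
      ∀ k z, (X.obj k).d i j (ψ k z) = ψj k (dualDiff (n + 1) k i j z) := by
  obtain ⟨ψ, h1, h2, h3⟩ := exists_relative_section hr i
    (X ⋙ HomologicalComplex.eval (ModuleCat.{0} ℤ) (ComplexShape.down ℤ) i)
    (fun k =>
      { carrier := {q | (p.app k).f i q.2 = degreeMap b i k q.1 ∧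
          (X.obj k).d i j q.2 = (ψj k ∘ₗ dualDiff (n + 1) k i j) q.1}
        zero_mem' := ⟨(map_zero _).trans (map_zero _).symm, (map_zero _).trans (map_zero _).symm⟩
        add_mem' := fun {q q'} h h' =>
          ⟨(map_add _ q.2 q'.2).trans
            ((congrArg₂ (· + ·) h.1 h'.1).trans (map_add _ q.1 q'.1).symm),
          (map_add _ q.2 q'.2).trans
            ((congrArg₂ (· + ·) h.2 h'.2).trans (map_add _ q.1 q'.1).symm)⟩
        neg_mem' := fun {q} h =>
          ⟨(map_neg _ q.2).trans ((congrArg _ h.1).trans (map_neg _ q.1).symm),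
          (map_neg _ q.2).trans ((congrArg _ h.2).trans (map_neg _ q.1).symm)⟩ })
    (fun {k k'} f z x h => by
      obtain ⟨h1, h2⟩ := h
      replace h1 : (p.app k).f i x = degreeMap b i k z := h1
      replace h2 : (X.obj k).d i j x = ψj k (dualDiff (n + 1) k i j z) := h2
      refine ⟨?_, ?_⟩
      · exact (map_f_app_f f i x).trans
          ((congrArg ((Y.map f).f i) h1).trans (map_degreeMap b f z))
      · change (X.obj k').d i j ((X.map f).f i x) = ψj k' (dualDiff (n + 1) k' i j _)
        rw [← dualActionMap_dualDiff, ← hj.natural, ← h2]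
        exact ConcreteCategory.congr_hom ((X.map f).comm i j) x)
    (fun k z => by
      have := hq k
      -- The defect of `ψi` is a cycle because `ψj` already commutes with the next differential, and
      -- `p` kills it because `b` is a chain map. Subtracting a bounding element `y` of `ker p`
      -- removes it without changing the image under `p`.
      obtain ⟨y, hy, hy'⟩ := exists_preimage_of_quasiIso (p.app k) (hp k) hij hjl
        ((X.obj k).d i j (ψi k z) - ψj k (dualDiff (n + 1) k i j z))
        (by
          rw [map_sub, hcomm, dualDiff_dualDiff, map_zero, sub_zero]
          exact ConcreteCategory.congr_hom ((X.obj k).d_comp_d i j l) (ψi k z))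
        (by
          rw [map_sub, hj.fac_right, ← d_degreeMap, ← hi.fac_right, sub_eq_zero]
          exact (ConcreteCategory.congr_hom ((p.app k).comm i j) (ψi k z)).symm)
      refine ⟨ψi k z - y, ?_, ?_⟩
      · change (p.app k).f i (ψi k z - y) = degreeMap b i k z
        rw [map_sub, hy', sub_zero, hi.fac_right]
      · change (X.obj k).d i j (ψi k z - y) = ψj k (dualDiff (n + 1) k i j z)
        rw [map_sub, hy, sub_sub_cancel])
    (degreeMap a i) (map_degreeMap a)
    (fun k y => by
      refine ⟨?_, ?_⟩
      · change (p.app k).f i (degreeMap a i k y) = degreeMap b i k _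
        rw [← hi.fac_left, hi.fac_right]
      · change (X.obj k).d i j (degreeMap a i k y) = ψj k (dualDiff (n + 1) k i j _)
        rw [← dualSuspensionMap_dualDiff, hj.fac_left, d_degreeMap])
  exact ⟨ψ, ⟨h1, fun k z => (h2 k z).1, h3⟩, fun k z => (h2 k z).2⟩

theorem exists_isDegreeLift_comm_le (hr : 0 < r) (hq : ∀ k, QuasiIso (p.app k))
    (hp : ∀ k m, Function.Surjective ((p.app k).f m))
    (hab : ∀ m k y, (p.app k).f m (degreeMap a m k y) =
      degreeMap b m k (dualSuspensionMap n k m y)) (N : ℕ) :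
    ∃ ψ : ∀ m k, dualModule (n + 1) k m →ₗ[ℤ] (X.obj k).X m,
      (∀ m, IsDegreeLift p a b m (ψ m)) ∧
      -- The bound without `N` is that of `dualModule_eq_zero`, below which the source vanishes.
      ∀ j, j + 1 < ((n + 1 : ℕ) : ℤ) * (r - 1) - r * (r * (n + 1 : ℕ)) + N → ∀ k z,
        (X.obj k).d (j + 1) j (ψ (j + 1) k z) = ψ j k (dualDiff (n + 1) k (j + 1) j z) := by
  induction N with
  | zero =>
    choose ψ hψ using exists_isDegreeLift (p := p) (a := a) (b := b) hr hp hab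
    refine ⟨ψ, hψ, fun j hj k z => ?_⟩
    rw [dualModule_eq_zero (Or.inl (by simpa using hj)) z]
    simp only [map_zero]
  | succ N ih =>
    obtain ⟨ψ, hψ, hcomm⟩ := ih
    obtain ⟨j, hj⟩ : ∃ j : ℤ,
        j + 1 = ((n + 1 : ℕ) : ℤ) * (r - 1) - r * (r * (n + 1 : ℕ)) + N := ⟨_, sub_add_cancel _ 1⟩
    rw [← hj] at hcomm
    have hcommj : ∀ k z, (X.obj k).d j (j - 1) (ψ j k z) =
        ψ (j - 1) k (dualDiff (n + 1) k j (j - 1) z) := by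
      have := hcomm (j - 1) (by omega)
      rwa [sub_add_cancel] at this
    obtain ⟨φ, hφ, hφcomm⟩ := exists_isDegreeLift_comm hr hq hp (rfl : j + 1 = j + 1)
      (sub_add_cancel j 1) (hψ (j + 1)) (hψ j) hcommj
    -- Only the component of degree `j + 1` changes. This may break commutation with the
    -- differential from degree `j + 2`, which is not yet claimed.
    refine ⟨Function.update ψ (j + 1) φ, fun m => ?_, fun i hi => ?_⟩
    · by_cases hm : m = j + 1
      · subst hm; rwa [Function.update_self]
      · rw [Function.update_of_ne hm]; exact hψ m
    · have hi' : i ≤ j := by push_cast at hi hj; omega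
      rw [Function.update_of_ne (show i ≠ j + 1 by omega)]
      rcases hi'.lt_or_eq with h | rfl
      · rw [Function.update_of_ne (show i + 1 ≠ j + 1 by omega)]
        exact hcomm i (by omega)
      · rwa [Function.update_self]

theorem exists_lift (hr : 0 < r) (hq : ∀ k, QuasiIso (p.app k))
    (hp : ∀ k m, Function.Surjective ((p.app k).f m))
    (hab : a ≫ p = (sigmaStar n).hom r ≫ b) :
    ∃ h : dualDiagram (n + 1) r ⟶ X, (sigmaStar n).hom r ≫ h = a ∧ h ≫ p = b := by
  obtain ⟨ψ, hψ, hcomm⟩ := exists_isDegreeLift_comm_le hr hq hp (fun m k y =>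
    ConcreteCategory.congr_hom (HomologicalComplex.congr_hom (NatTrans.congr_app hab k) m) y)
    -- This number of steps reaches past the top degree `(n + 1)(r - 1)`, above which the source
    -- vanishes again.
    (r * (r * (n + 1)) + 2)
  have hd : ∀ i j, j + 1 = i → ∀ k z,
      (X.obj k).d i j (ψ i k z) = ψ j k (dualDiff (n + 1) k i j z) := by
    rintro i j rfl k z
    by_cases hj : ((n + 1 : ℕ) : ℤ) * (r - 1) < j + 1
    · rw [dualModule_eq_zero (Or.inr hj) z]
      simp only [map_zero]
    · refine hcomm j ?_ k z
      push_cast at hj ⊢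
      linarith
  let h : dualDiagram (n + 1) r ⟶ X :=
    { app := fun k =>
        { f := fun m => ModuleCat.ofHom (ψ m k)
          comm' := fun i j hij => by
            ext z
            exact hd i j hij k z }
      naturality := fun k l f => by
        ext m z
        exact ((hψ m).natural f z).symm }
  refine ⟨h, ?_, ?_⟩
  · ext k m y
    exact (hψ m).fac_left k y
  · ext k m z
    exact (hψ m).fac_right k z

end Lifting

end BarrattEccles

/-! ### Assembly of the lifts over all arities. -/

/-- The dual suspension `σ^* : D_{n-1} → D_n` is a cofibration of symmetric `K`-diagrams for all
`n > 1`; equivalently, with the index shifted by one, `σ^* : D_n → D_{n+1}` for all `n ≥ 1`. -/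
theorem mainTheorem10 (n : ℕ) (hn : 1 ≤ n) :
    BarrattEccles.cofibrations (BarrattEccles.sigmaStar n) := by
  intro X Y p hp
  refine ⟨fun {a b} sq => ⟨⟨?_⟩⟩⟩
  have key : ∀ r, ∃ h : BarrattEccles.dualDiagram (n + 1) r ⟶ X.obj r,
      (BarrattEccles.sigmaStar n).hom r ≫ h = a.hom r ∧ h ≫ p.hom r = b.hom r := by
    intro r
    rcases Nat.eq_zero_or_pos r with rfl | hr
    · have : IsEmpty (BarrattEccles.KSigma 0) := ⟨fun k => absurd k.arity_pos (lt_irrefl 0)⟩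
      refine ⟨{ app := fun k => isEmptyElim k, naturality := fun k => isEmptyElim k }, ?_, ?_⟩ <;>
        exact NatTrans.ext (funext fun k => isEmptyElim k)
    · exact BarrattEccles.exists_lift hr (hp.1 r) (hp.2 r)
        (congrFun (congrArg (fun q => q.hom) sq.w) r)
  choose h h1 h2 using key
  exact
    { l := ObjectProperty.homMk h
      fac_left := ObjectProperty.hom_ext _ (funext h1)
      fac_right := ObjectProperty.hom_ext _ (funext h2) }
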